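/- **Theorem (1-private commitment capacity of the degraded binary symmetric broadcast wiretap channel).** Let $0<p,q<1/2$ and let $W_{Y,Z|X}$ be a D-BS-BC$(p,q)$: a memoryless wiretap channel with $\mathcal X=\mathcal Y=\mathcal Z=\{0,1\}$ whose marginals $W_{Y|X}$ (Alice to Bob) and $W_{Z|X}$ (Alice to Eve) are the binary symmetric channels BSC$(p)$ and BSC$(q)$, and for which $W_{Y,Z|X}=W_{Y|X}W_{Z|Y}$ for some channel $W_{Z|Y}$ (that is, $X-Y-Z$ is a Markov chain). Then its commitment capacity under 1-privacy is $$\mathbb C_1=H(p):=-p\log_2p-(1-p)\log_2(1-p).$$ Here the terms are as follows. An $(n,R)$-commitment protocol ($R\ge 0$) has a commit phase and a reveal phase. The commit string $C$ is uniform on $[2^{nR}]=\{1,\dots,\lfloor 2^{nR}\rfloor\}$; Alice and Bob have private random keys $K_A,K_B$ with finite alphabets, and $C,K_A,K_B$ are independent. In the commit phase Alice uses the channel $n$ times with inputs $\mathbf X=(X_1,\dots,X_n)$; Bob receives $\mathbf Y$ and Eve receives $\mathbf Z$. Before each channel use, and after the last one, Alice and Bob exchange finitely many messages from a finite alphabet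 over a public noiseless link, heard by Eve. All messages and channel inputs of a party depend causally on what that party knows at the time. Let $M$ be the whole transcript. The views at the end of the commit phase are $V_A=(C,K_A,\mathbf X,M)$, $V_B=(K_B,\mathbf Y,M)$ and $V_E=(\mathbf Z,M)$. In the reveal phase Alice announces a pair $(\tilde c,\tilde{\mathbf x})\in[2^{nR}]\times\{0,1\}^n$, which Bob accepts if $T(\tilde c,\tilde{\mathbf x},V_B)=1$ and rejects otherwise. For $\epsilon>0$ the protocol is * $\epsilon$-sound if $\mathbb P(T(C,\mathbf X,V_B)\ne1)\le\epsilon$ for honest Alice and Bob; * $\epsilon$-1-concealing if $I(C;V_B)\le\epsilon$ for honest Alice and every strategy of a malicious Bob in the commit phase; * $\epsilon$-1-binding if for honest Bob, every strategy of a malicious Alice in the commit phase, and every cheating function $\mathcal A$ with $((\bar c,\bar{\mathbf x}),(\hat c,\hat{\mathbf x}))=\mathcal A(V_A)$, the probability that $\bar c\ne\hat c$, $T(\bar c,\bar{\mathbf x},V_B)=1$ and $T(\hat c,\hat{\mathbf x},V_B)=1$ is at most $\epsilon$; * $\epsilon$-secure if $I(C;V_E)\le\epsilon$ for honest Alice and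 Bob. A rate $R\ge0$ is achievable under 1-privacy if for every $\epsilon>0$ and all sufficiently large $n$ there is an $(n,R)$-commitment protocol that is $\epsilon$-sound, $\epsilon$-1-concealing, $\epsilon$-1-binding and $\epsilon$-secure. The 1-private commitment capacity $\mathbb C_1$ is the supremum of the rates achievable under 1-privacy. -/

import Mathlib

open Finset

noncomputable section

namespace WiretapCommitment

/-! ### Finite probability: events and mutual information -/

section Probability

variable {Ω α β : Type*} [Fintype Ω]

open Classical in
/-- Probability of the event `A` under the mass function `μ` on a finite sample space. -/
def prob (μ : Ω → ℝ) (A : Set Ω) : ℝ := ∑ ω with ω ∈ A, μ ω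

open Classical in
/-- Mutual information `I(U;V)`, in bits, of two random variables on a finite sample space.
A term with `P(U = u, V = v) = 0` is `0`, as usual. -/
def mutualInfo (μ : Ω → ℝ) (U : Ω → α) (V : Ω → β) : ℝ :=
  ∑ u ∈ univ.image U, ∑ v ∈ univ.image V,
    prob μ {ω | U ω = u ∧ V ω = v} *
      Real.logb 2 (prob μ {ω | U ω = u ∧ V ω = v} /
        (prob μ {ω | U ω = u} * prob μ {ω | V ω = v}))

end Probability

/-! ### Wiretap channels -/

/-- Memoryless wiretap channel law `W_{Y,Z|X}`: the input is Alice's, the first output is Bob's,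
the second output is Eve's. -/
abbrev WiretapChannel (X Y Z : Type) := X → PMF (Y × Z)

/-- The marginal law `W_{Y|X}`. -/
def WiretapChannel.toBob {X Y Z : Type} (W : WiretapChannel X Y Z) (x : X) : PMF Y :=
  (W x).map Prod.fst

/-- The marginal law `W_{Z|X}`. -/
def WiretapChannel.toEve {X Y Z : Type} (W : WiretapChannel X Y Z) (x : X) : PMF Z :=
  (W x).map Prod.snd

/-- `V` is the binary symmetric channel with crossover probability `p`. -/
def IsBSC (V : Bool → PMF Bool) (p : ℝ) : Prop :=
  ∀ x y, (V x y).toReal = if y = x then 1 - p else p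

/-- `W` belongs to the class BS-BC(p,q): binary alphabets, `0 < p, q < 1/2`, and the marginal
channels to Bob and to Eve are BSC(p) and BSC(q). -/
structure IsBSBC (W : WiretapChannel Bool Bool Bool) (p q : ℝ) : Prop where
  p_mem : p ∈ Set.Ioo (0 : ℝ) (1 / 2)
  q_mem : q ∈ Set.Ioo (0 : ℝ) (1 / 2)
  bob : IsBSC W.toBob p
  eve : IsBSC W.toEve q

/-- `W` is a D-BS-BC(p,q): a BS-BC(p,q) for which `W_{Y,Z|X} = W_{Y|X} W_{Z|Y}` for some channel
`W_{Z|Y}` from Bob's output to Eve's, that is, `X - Y - Z` is a Markov chain. -/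
structure IsDegradedBSBC (W : WiretapChannel Bool Bool Bool) (p q : ℝ) : Prop
    extends IsBSBC W p q where
  degraded : ∃ V : Bool → PMF Bool, ∀ x y z, W x (y, z) = W.toBob x y * V y z

/-! ### Strategies in the commit phase

The commit phase has stages `0, 1, …, n`. In stage `i` Alice and Bob exchange finitely many
messages over the public noiseless link, alternately, Alice first (a party with nothing to say
sends a dummy message). Between stage `i` and stage `i + 1`, Alice makes the `i`-th use
(`i = 0, …, n - 1`) of the wiretap channel. -/

/-- A (possibly malicious) strategy of Alice: a private key with an arbitrary law, and the rules by
which she computes, from the commit string, her key and the transcript so far, her next public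
message and her `i`-th channel input. (Her previous channel inputs are functions of these data.) -/
structure AliceStrategy (N n : ℕ) (Msg : Type) where
  Key : Type
  [fintypeKey : Fintype Key]
  keyLaw : PMF Key
  msg : Fin N → Key → List Msg → Msg
  input : Fin N → Key → Fin n → List Msg → Bool

/-- A (possibly malicious) strategy of Bob: a private key with an arbitrary law, and the rule by
which he computes, from his key, the list of channel outputs that he has received so far and the
transcript so far, his next public message. -/
structure BobStrategy (Msg : Type) where
  Key : Type
  [fintypeKey : Fintype Key]
  keyLaw : PMF Key
  msg : Key → List Bool → List Msg → Msg

attribute [instance] AliceStrategy.fintypeKey BobStrategy.fintypeKey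

/-- The transcript `t` extended by `r` rounds, in each of which first Alice (rule `a`) and then Bob
(rule `b`) sends a message that depends on the transcript so far. -/
def exchange {Msg : Type} (a b : List Msg → Msg) : ℕ → List Msg → List Msg
  | 0, t => t
  | r + 1, t => exchange a b r ((t ++ [a t]) ++ [b (t ++ [a t])])

/-- The transcript at the end of stage `i`, when `rounds j` rounds take place in stage `j`, Alice's
messages follow `a`, Bob's follow `b` (whose first argument is the list of the channel outputs
received so far), and `y` is the vector of Bob's channel outputs. -/
def transcriptAt {Msg : Type} {n : ℕ} (rounds : ℕ → ℕ) (a : List Msg → Msg)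
    (b : List Bool → List Msg → Msg) (y : Fin n → Bool) : ℕ → List Msg
  | 0 => exchange a (b []) (rounds 0) []
  | i + 1 => exchange a (b ((List.ofFn y).take (i + 1))) (rounds (i + 1))
      (transcriptAt rounds a b y i)

/-! ### The random experiment of the commit phase -/

section Experiment

variable {N n : ℕ} {Msg : Type} (W : WiretapChannel Bool Bool Bool) (rounds : ℕ → ℕ)
  (a : AliceStrategy N n Msg) (b : BobStrategy Msg)

/-- Outcomes `(c, k_A, k_B, y, z)`; the channel inputs and the transcript are functions of these. -/
abbrev Outcome := Fin N × a.Key × b.Key × (Fin n → Bool) × (Fin n → Bool)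

variable {a b} in
/-- The commit string `C`. -/
def commitString (ω : Outcome a b) : Fin N := ω.1

variable {a b} in
/-- The vector `Y` of Bob's channel outputs. -/
def bobOutput (ω : Outcome a b) : Fin n → Bool := ω.2.2.2.1

variable {a b} in
/-- The vector `Z` of Eve's channel outputs. -/
def eveOutput (ω : Outcome a b) : Fin n → Bool := ω.2.2.2.2

variable {a b} in
/-- The transcript at the end of stage `i`. -/
def stageTranscript (ω : Outcome a b) (i : ℕ) : List Msg :=
  transcriptAt rounds (a.msg ω.1 ω.2.1) (b.msg ω.2.2.1) (bobOutput ω) i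

variable {a b} in
/-- The whole transcript `M` of the commit phase. -/
def transcript (ω : Outcome a b) : List Msg := stageTranscript rounds ω n

variable {a b} in
/-- The vector `X` of Alice's channel inputs. -/
def channelInput (ω : Outcome a b) (i : Fin n) : Bool :=
  a.input ω.1 ω.2.1 i (stageTranscript rounds ω i)

/-- The joint law: `C` is uniform, `C`, `K_A`, `K_B` are independent, and the memoryless channel
turns each input `x_i` into `(y_i, z_i)` with probability `W_{Y,Z|X}(y_i, z_i | x_i)`. -/
def law (ω : Outcome a b) : ℝ :=
  (1 / (N : ℝ)) * (a.keyLaw ω.2.1).toReal * (b.keyLaw ω.2.2.1).toReal *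
    ∏ i, (W (channelInput rounds ω i) (bobOutput ω i, eveOutput ω i)).toReal

/-- Alice's view `V_A = (C, K_A, X, M)`. -/
abbrev AliceView (a : AliceStrategy N n Msg) := Fin N × a.Key × (Fin n → Bool) × List Msg

/-- Bob's view `V_B = (K_B, Y, M)`. -/
abbrev BobView (n : ℕ) (b : BobStrategy Msg) := b.Key × (Fin n → Bool) × List Msg

variable {a b} in
/-- Alice's view at the end of the commit phase. -/
def aliceView (ω : Outcome a b) : AliceView a :=
  (ω.1, ω.2.1, channelInput rounds ω, transcript rounds ω)

variable {a b} in
/-- Bob's view at the end of the commit phase. -/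
def bobView (ω : Outcome a b) : BobView n b := (ω.2.2.1, bobOutput ω, transcript rounds ω)

variable {a b} in
/-- Eve's view `V_E = (Z, M)` at the end of the commit phase. -/
def eveView (ω : Outcome a b) : (Fin n → Bool) × List Msg := (eveOutput ω, transcript rounds ω)

end Experiment

/-! ### Commitment protocols and their security -/

/-- A commitment protocol for commit strings in a set of size `N` with `n` channel uses: finite
message alphabet, number of rounds in each stage, strategies of honest Alice and honest Bob in the
commit phase, and Bob's test `T(c̃, x̃, V_B)` in the reveal phase. -/
structure CommitmentProtocol (N n : ℕ) where
  Msg : Type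
  finiteMsg : Finite Msg
  rounds : ℕ → ℕ
  alice : AliceStrategy N n Msg
  bob : BobStrategy Msg
  test : Fin N → (Fin n → Bool) → BobView n bob → Bool

namespace CommitmentProtocol

variable {N n : ℕ} (P : CommitmentProtocol N n) (W : WiretapChannel Bool Bool Bool) (ε : ℝ)

/-- Honest parties: Bob rejects the true pair `(C, X)` with probability at most `ε`. -/
def IsSound : Prop :=
  prob (law W P.rounds P.alice P.bob)
    {ω | P.test (commitString ω) (channelInput P.rounds ω) (bobView P.rounds ω) ≠ true} ≤ ε

/-- Honest Alice, arbitrary strategy `b` of Bob in the commit phase: `I(C; V_B) ≤ ε`. -/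
def IsOneConcealing : Prop :=
  ∀ b : BobStrategy P.Msg,
    mutualInfo (law W P.rounds P.alice b) commitString (bobView P.rounds) ≤ ε

/-- Honest Bob, arbitrary strategy `a` of Alice in the commit phase and arbitrary cheating function
`A` of her view: with probability at most `ε` the two pairs `A(V_A)` have distinct commit strings
and are both accepted. -/
def IsOneBinding : Prop :=
  ∀ (a : AliceStrategy N n P.Msg)
    (A : AliceView a → (Fin N × (Fin n → Bool)) × (Fin N × (Fin n → Bool))),
    prob (law W P.rounds a P.bob)
      {ω | (A (aliceView P.rounds ω)).1.1 ≠ (A (aliceView P.rounds ω)).2.1 ∧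
        P.test (A (aliceView P.rounds ω)).1.1 (A (aliceView P.rounds ω)).1.2
          (bobView P.rounds ω) = true ∧
        P.test (A (aliceView P.rounds ω)).2.1 (A (aliceView P.rounds ω)).2.2
          (bobView P.rounds ω) = true} ≤ ε

/-- Honest parties, eavesdropper Eve: `I(C; V_E) ≤ ε`. Eve is passive, and local processing of her
view `V_E = (Z, M)` cannot increase the information. -/
def IsSecure : Prop :=
  mutualInfo (law W P.rounds P.alice P.bob) commitString (eveView P.rounds) ≤ ε

end CommitmentProtocol

/-- The rate `R` is achievable under 1-privacy over the wiretap channel `W`. The commit strings of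
an `(n,R)`-protocol are the elements of `[2^{nR}] = {1, …, ⌊2^{nR}⌋}`. -/
def AchievableOnePrivate (W : WiretapChannel Bool Bool Bool) (R : ℝ) : Prop :=
  0 ≤ R ∧ ∀ ε : ℝ, 0 < ε → ∃ n₀ : ℕ, ∀ n : ℕ, n₀ ≤ n →
    ∃ P : CommitmentProtocol ⌊(2 : ℝ) ^ ((n : ℝ) * R)⌋₊ n,
      P.IsSound W ε ∧ P.IsOneConcealing W ε ∧ P.IsOneBinding W ε ∧ P.IsSecure W ε

/-- `C₁` is the 1-private commitment capacity of `W`, the supremum of the achievable rates. -/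
def IsOnePrivateCapacity (W : WiretapChannel Bool Bool Bool) (C₁ : ℝ) : Prop :=
  IsLUB {R : ℝ | AchievableOnePrivate W R} C₁

/-- The binary entropy function `H(p) = -p log₂ p - (1-p) log₂ (1-p)`, in bits. -/
def binaryEntropy (p : ℝ) : ℝ := -p * Real.logb 2 p - (1 - p) * Real.logb 2 (1 - p)

end WiretapCommitment

end

open Finset

noncomputable section

namespace WiretapCommitment

/-! ### Product sums, exponential tail bounds and Hamming balls -/

/-! Degradedness makes Bob's noise `X ⊕ Y` i.i.d. with parameter `p` and independent of the commit
string and all keys, even when inputs depend on earlier outputs through the public discussion. Eve's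
output is then generated from `Y` alone, so she adds nothing to what Bob knows about `X`.

Converse. The pair (inputs `X`, transcript `M`) has rectangular fibres: given it, Alice's private
data and Bob's are independent. Hence some label `D (X, M)` is accepted by Bob at least as often as
the true `C`. If `D (X, M)` differed from `C`, Alice could usually open both, so binding and
soundness force `C = D (X, M)` outside an event of probability `3ε`
(`CommitmentProtocol.exists_decoder`). As `X` is typically within `n (p + δ)` of `Y`, Bob obtains a
list of about `2 ^ (n H(p))` candidates for `C`. If `R > H(p)`, this list is exponentially smaller
than the set of commit strings, and `list_decoding_le_mutualInfo` contradicts concealment, already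
for an honest Bob.

Achievability. Alice sends a uniform word `x`; after the last channel use Bob sends a random hash
`G` with about `2 ^ (n η)` values; Alice answers with `G x`, a random function `S` and `c + S x`. A
word accepted by Bob is close to `x` with high probability because `p < 1/2`, and `G` is injective
on the small ball around `x` with high probability, so only one word can be opened
(`prob_double_opening_le`). Given `Y`, `Z` and `G x`, the word `x` retains about `n (H(p) - η) - n
η` bits of uncertainty, and a leftover hash argument (`leftover_hash`, `mutualInfo_le_of_collision`)
shows that `S x` masks `c` whenever `R` is below this (`mutualInfo_hashProtocol_le`). -/

theorem sum_prod_bits {n : ℕ} {A : Type*} [Fintype A] (f : Fin n → A → ℝ) :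
    ∑ e : Fin n → A, ∏ i, f i (e i) = ∏ i, ∑ b, f i b := by
  classical
  rw [Finset.prod_univ_sum, Fintype.piFinset_univ]

/-- Exponential Markov inequality for a sum of independent terms. -/
theorem chernoff {n : ℕ} {ρ : Bool → ℝ} (hρ : ∀ b, 0 ≤ ρ b) (g : Fin n → Bool → ℝ) {s θ : ℝ}
    (hs : 0 ≤ s) (h : ∀ i, ∑ b, ρ b * Real.exp (s * g i b) ≤ θ) :
    ∑ e : Fin n → Bool, (if 0 ≤ ∑ i, g i (e i) then ∏ i, ρ (e i) else 0) ≤ θ ^ n := by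
  calc _ ≤ ∑ e : Fin n → Bool, ∏ i, (ρ (e i) * Real.exp (s * g i (e i))) := by
        refine sum_le_sum fun e _ => ?_
        rw [prod_mul_distrib, ← Real.exp_sum, ← mul_sum]
        have h0 : 0 ≤ ∏ i, ρ (e i) := prod_nonneg fun i _ => hρ _
        split_ifs with he
        · exact le_mul_of_one_le_right h0 (Real.one_le_exp (mul_nonneg hs he))
        · exact mul_nonneg h0 (Real.exp_pos _).le
    _ = ∏ i, ∑ b, ρ b * Real.exp (s * g i b) :=
        sum_prod_bits fun i b => ρ b * Real.exp (s * g i b)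
    _ ≤ ∏ _i : Fin n, θ := prod_le_prod
        (fun i _ => sum_nonneg fun b _ => mul_nonneg (hρ b) (Real.exp_pos _).le) fun i _ => h i
    _ = θ ^ n := by simp

open Filter Topology in
/-- A bounded variable with negative mean has exponential moments below `1`. -/
theorem eventually_exp_moment_lt_one {ρ : Bool → ℝ} (h1 : ∑ b, ρ b = 1) (g : Bool → ℝ)
    (hg : ∑ b, ρ b * g b < 0) : ∀ᶠ s in 𝓝[>] (0 : ℝ), ∑ b, ρ b * Real.exp (s * g b) < 1 := by
  have hd : HasDerivAt (fun s : ℝ => ∑ b, ρ b * Real.exp (s * g b)) (∑ b, ρ b * g b) 0 := by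
    refine HasDerivAt.fun_sum fun b _ => ?_
    have := (((hasDerivAt_id (0 : ℝ)).mul_const (g b)).exp).const_mul (ρ b)
    simpa using this
  have ht := (hd.tendsto_slope.mono_left (nhdsGT_le_nhdsNE (0 : ℝ))).eventually (gt_mem_nhds hg)
  filter_upwards [ht, self_mem_nhdsWithin] with s hs hs0
  rw [slope_def_field] at hs
  have hs0' : 0 < s := hs0
  rw [div_lt_iff₀ (by simpa using hs0')] at hs
  simp only [zero_mul, Real.exp_zero, mul_one, h1] at hs
  linarith

/-- Size of a Hamming ball. -/
theorem card_ball_mul_le {n : ℕ} (y : Fin n → Bool) (r : ℝ) {c : ℝ} (h0 : 0 < c) (h1 : c ≤ 1) :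
    (#{x : Fin n → Bool | (hammingDist x y : ℝ) ≤ r} : ℝ) * c ^ r ≤ (1 + c) ^ n := by
  calc (#{x : Fin n → Bool | (hammingDist x y : ℝ) ≤ r} : ℝ) * c ^ r
      = ∑ x : Fin n → Bool with (hammingDist x y : ℝ) ≤ r, c ^ r := by simp
    _ ≤ ∑ x : Fin n → Bool with (hammingDist x y : ℝ) ≤ r, ∏ i, (if x i ≠ y i then c else 1) := by
        refine sum_le_sum fun x hx => ?_
        rw [mem_filter_univ] at hx
        rw [prod_ite]
        simp only [prod_const, one_pow, mul_one]
        rw [← Real.rpow_natCast]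
        exact Real.rpow_le_rpow_of_exponent_ge h0 h1 hx
    _ ≤ ∑ x : Fin n → Bool, ∏ i, (if x i ≠ y i then c else 1) :=
        sum_le_sum_of_subset_of_nonneg (filter_subset _ _) fun x _ _ =>
          prod_nonneg fun i _ => by split_ifs <;> linarith
    _ = ∏ i, ∑ b, (if b ≠ y i then c else 1) :=
        sum_prod_bits fun i b => if b ≠ y i then c else 1
    _ = (1 + c) ^ n := by
        have : ∀ i, ∑ b, (if b ≠ y i then c else 1) = 1 + c := fun i => by
          cases y i <;> simp [add_comm]
        rw [prod_congr rfl fun i _ => this i]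
        simp

theorem hammingDist_eq_sum {n : ℕ} (x y : Fin n → Bool) :
    (hammingDist x y : ℝ) = ∑ i, if x i ≠ y i then (1 : ℝ) else 0 := by
  rw [sum_boole, hammingDist]

/-- The law of one noise bit of the binary symmetric channel. -/
def noiseBit (p : ℝ) (b : Bool) : ℝ := if b then p else 1 - p

theorem noiseBit_nonneg {p : ℝ} (h0 : 0 ≤ p) (h1 : p ≤ 1) (b : Bool) : 0 ≤ noiseBit p b := by
  unfold noiseBit; split_ifs <;> linarith

theorem noiseBit_pos {p : ℝ} (h0 : 0 < p) (h1 : p < 1) (b : Bool) : 0 < noiseBit p b := by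
  unfold noiseBit; split_ifs <;> linarith

theorem sum_noiseBit (p : ℝ) : ∑ b, noiseBit p b = 1 := by simp [noiseBit]

theorem sum_noiseBit_mul (p : ℝ) (g : Bool → ℝ) :
    ∑ b, noiseBit p b * g b = p * g true + (1 - p) * g false := by simp [noiseBit]

/-- The law of the noise vector. -/
def noiseLaw (p : ℝ) {n : ℕ} (e : Fin n → Bool) : ℝ := ∏ i, noiseBit p (e i)

theorem noiseLaw_nonneg {p : ℝ} (h0 : 0 ≤ p) (h1 : p ≤ 1) {n : ℕ} (e : Fin n → Bool) :
    0 ≤ noiseLaw p e := prod_nonneg fun _ _ => noiseBit_nonneg h0 h1 _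

theorem sum_noiseLaw (p : ℝ) (n : ℕ) : ∑ e : Fin n → Bool, noiseLaw p e = 1 := by
  unfold noiseLaw
  rw [sum_prod_bits fun _ b => noiseBit p b]
  rw [sum_noiseBit, prod_const_one]

/-- The sum of two bit vectors. -/
def bxor {n : ℕ} (x y : Fin n → Bool) : Fin n → Bool := fun i => xor (x i) (y i)

theorem bxor_bxor {n : ℕ} (x y : Fin n → Bool) : bxor x (bxor x y) = y := by
  funext i; simp [bxor]

theorem sum_bxor {n : ℕ} (x : Fin n → Bool) (f : (Fin n → Bool) → ℝ) :
    ∑ y, f (bxor x y) = ∑ e, f e :=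
  Equiv.sum_comp (Function.Involutive.toPerm (bxor x) (bxor_bxor x)) f

/-- The channel adds noise in more than `n (p + δ)` places with exponentially small probability. -/
theorem exists_noise_upper_tail {p δ : ℝ} (h0 : 0 < p) (h1 : p < 1) (hδ : 0 < δ) :
    ∃ θ ∈ Set.Ioo (0 : ℝ) 1, ∀ (n : ℕ) (x : Fin n → Bool),
      ∑ y, (if n * (p + δ) < hammingDist x y then noiseLaw p (bxor x y) else 0) ≤ θ ^ n := by
  -- The shifted noise bit has mean `-δ`, so a small tilt `s` brings its exponential moment below
  -- `1`; that moment serves as `θ`.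
  obtain ⟨s, hs, hs0⟩ := ((eventually_exp_moment_lt_one (sum_noiseBit p)
    (fun b => (if b then 1 else 0) - (p + δ)) (by rw [sum_noiseBit_mul]; simp; nlinarith)).and
      self_mem_nhdsWithin).exists
  have hs0 : 0 < s := hs0
  refine ⟨_, ⟨sum_pos (fun b _ => mul_pos (noiseBit_pos h0 h1 b) (Real.exp_pos _)) ⟨true, mem_univ _⟩,
    hs⟩, fun n x => ?_⟩
  refine le_trans (sum_le_sum fun y _ => ?_) ((sum_bxor x _).le.trans
    (chernoff (noiseBit_nonneg h0.le h1.le)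
      (fun _ : Fin n => fun b => (if b then 1 else 0) - (p + δ)) hs0.le fun _ => le_rfl))
  have hd : (hammingDist x y : ℝ) = ∑ i, if bxor x y i = true then (1 : ℝ) else 0 := by
    rw [hammingDist_eq_sum]
    refine sum_congr rfl fun i _ => ?_
    refine if_congr ?_ rfl rfl
    simp only [bxor]
    cases x i <;> cases y i <;> simp
  have hn := noiseLaw_nonneg h0.le h1.le (bxor x y)
  rw [sum_sub_distrib, ← hd]
  simp only [sum_const, card_univ, Fintype.card_fin, nsmul_eq_mul, sub_nonneg]
  split_ifs with h2 h3 h3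
  · rfl
  · exact absurd h2.le h3
  · exact hn
  · rfl

/-- A word at distance at least `α n` from the input is accepted with exponentially small
probability. -/
theorem exists_noise_far_tail {p α : ℝ} (h0 : 0 < p) (h1 : p < 1 / 2) (hα : 0 < α) :
    ∃ θ ∈ Set.Ioo (0 : ℝ) 1, ∀ (n : ℕ) (x u : Fin n → Bool), n * α ≤ hammingDist x u →
      ∑ y, (if hammingDist u y ≤ n * (p + α * (1 - 2 * p) / 4) then noiseLaw p (bxor x y) else 0)
        ≤ θ ^ n := by
  set δ := α * (1 - 2 * p) / 4 with hδ
  have hδ0 : 0 < δ := by rw [hδ]; apply div_pos (mul_pos hα (by linarith)); norm_num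
  -- Here `v` marks the places where `u` differs from `x`. There `u` disagrees with the output with
  -- probability `1 - p`, so even after the bonus `(1 - 2p)/2` the mean stays negative; elsewhere it
  -- is `-δ`. The choice of `δ` makes `α (1 - 2p)/2 = 2δ`, so that the bonuses over `n α` places pay
  -- exactly for passing from `p - δ` to `p + δ`.
  let g : Bool → Bool → ℝ := fun v b =>
    (p - δ) + (if v then (1 - 2 * p) / 2 else 0) - (if xor v b then 1 else 0)
  have hneg : ∀ v, ∑ b, noiseBit p b * g v b < 0 := by
    intro v
    rw [sum_noiseBit_mul]
    cases v <;> simp [g] <;> nlinarith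
  obtain ⟨s, ⟨hst, hsf⟩, hs0⟩ :=
    (((eventually_exp_moment_lt_one (sum_noiseBit p) (g true) (hneg true)).and
      (eventually_exp_moment_lt_one (sum_noiseBit p) (g false) (hneg false))).and
      self_mem_nhdsWithin).exists
  have hs0 : 0 < s := hs0
  have hpos : ∀ v, 0 < ∑ b, noiseBit p b * Real.exp (s * g v b) := fun v =>
    sum_pos (fun b _ => mul_pos (noiseBit_pos h0 (by linarith) b) (Real.exp_pos _))
      ⟨true, mem_univ _⟩
  refine ⟨max (∑ b, noiseBit p b * Real.exp (s * g true b))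
    (∑ b, noiseBit p b * Real.exp (s * g false b)), ⟨lt_max_of_lt_left (hpos true),
      max_lt hst hsf⟩, fun n x u hxu => ?_⟩
  refine le_trans (sum_le_sum fun y _ => ?_) ((sum_bxor x _).le.trans
    (chernoff (noiseBit_nonneg h0.le (by linarith))
      (fun i : Fin n => g (xor (x i) (u i))) hs0.le fun i => ?_))
  · have hn := noiseLaw_nonneg h0.le (by linarith : p ≤ 1) (bxor x y)
    have e1 : (hammingDist u y : ℝ) =
        ∑ i, if xor (xor (x i) (u i)) (bxor x y i) = true then (1 : ℝ) else 0 := by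
      rw [hammingDist_eq_sum]
      refine sum_congr rfl fun i _ => ?_
      refine if_congr ?_ rfl rfl
      simp only [bxor]
      cases x i <;> cases y i <;> cases u i <;> simp
    have e2 : ∑ i, (if xor (x i) (u i) = true then (1 - 2 * p) / 2 else 0)
        = (1 - 2 * p) / 2 * hammingDist x u := by
      rw [hammingDist_eq_sum, mul_sum]
      refine sum_congr rfl fun i _ => ?_
      rw [mul_ite, mul_one, mul_zero]
      refine if_congr ?_ rfl rfl
      cases x i <;> cases u i <;> simp
    have e3 : ∑ i, g (xor (x i) (u i)) (bxor x y i)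
        = n * (p - δ) + (1 - 2 * p) / 2 * hammingDist x u - hammingDist u y := by
      simp only [g]
      rw [sum_sub_distrib, sum_add_distrib, e2, ← e1]
      simp only [sum_const, card_univ, Fintype.card_fin, nsmul_eq_mul]
    rw [e3]
    split_ifs with h2 h3 h3
    · rfl
    · exfalso; apply h3
      have : (1 - 2 * p) / 2 * (n * α) ≤ (1 - 2 * p) / 2 * hammingDist x u :=
        mul_le_mul_of_nonneg_left hxu (by linarith)
      rw [hδ] at *
      nlinarith
    · exact hn
    · rfl
  · cases xor (x i) (u i)
    · exact le_max_right _ _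
    · exact le_max_left _ _

/-- Noise of atypically large probability is exponentially unlikely. -/
theorem exists_noise_typical {p η : ℝ} (h0 : 0 < p) (h1 : p < 1) (hη : 0 < η) :
    ∃ θ ∈ Set.Ioo (0 : ℝ) 1, ∀ n : ℕ,
      ∑ e : Fin n → Bool,
        (if (2 : ℝ) ^ (-(n * (binaryEntropy p - η))) < noiseLaw p e then noiseLaw p e else 0)
          ≤ θ ^ n := by
  have hl2 : 0 < Real.log 2 := Real.log_pos one_lt_two
  -- The mean of `log (noiseBit p b)` is `-H(p) log 2`, so `g` has mean `-η log 2`.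
  let g : Bool → ℝ := fun b => Real.log (noiseBit p b) + (binaryEntropy p - η) * Real.log 2
  have hneg : ∑ b, noiseBit p b * g b < 0 := by
    rw [sum_noiseBit_mul]
    simp only [g, noiseBit, binaryEntropy, Real.logb]
    simp only [if_true, Bool.false_eq_true, if_false]
    have : (-p * (Real.log p / Real.log 2) - (1 - p) * (Real.log (1 - p) / Real.log 2) - η) *
        Real.log 2 = -p * Real.log p - (1 - p) * Real.log (1 - p) - η * Real.log 2 := by
      field_simp
    rw [this]
    nlinarith [mul_pos hη hl2]
  obtain ⟨s, hs, hs0⟩ := ((eventually_exp_moment_lt_one (sum_noiseBit p) g hneg).and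
      self_mem_nhdsWithin).exists
  have hs0 : 0 < s := hs0
  refine ⟨_, ⟨sum_pos (fun b _ => mul_pos (noiseBit_pos h0 h1 b) (Real.exp_pos _)) ⟨true, mem_univ _⟩,
    hs⟩, fun n => ?_⟩
  refine le_trans ?_ (chernoff (noiseBit_nonneg h0.le h1.le)
    (fun _ : Fin n => g) hs0.le fun _ => le_rfl)
  refine sum_le_sum fun e _ => ?_
  have hn := noiseLaw_nonneg h0.le h1.le e
  have e1 : ∑ i, g (e i) = Real.log (noiseLaw p e) + n * ((binaryEntropy p - η) * Real.log 2) := by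
    simp only [g]
    rw [sum_add_distrib, noiseLaw, Real.log_prod fun i _ => (noiseBit_pos h0 h1 _).ne']
    simp
  rw [e1]
  split_ifs with h2 h3 h3
  · rfl
  · exfalso; apply h3
    have := Real.log_le_log (by positivity) h2.le
    rw [Real.log_rpow two_pos] at this
    linarith
  · exact hn
  · rfl

/-! ### Finite probability -/

section Probability

variable {Ω α β β' : Type*} [Fintype Ω] {μ : Ω → ℝ}

open Classical in
theorem prob_eq_sum_ite (μ : Ω → ℝ) (A : Set Ω) : prob μ A = ∑ ω, if ω ∈ A then μ ω else 0 := by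
  rw [prob, sum_filter]

theorem prob_nonneg (hμ : ∀ ω, 0 ≤ μ ω) (A : Set Ω) : 0 ≤ prob μ A :=
  sum_nonneg fun ω _ => hμ ω

open Classical in
theorem prob_mono (hμ : ∀ ω, 0 ≤ μ ω) {A B : Set Ω} (h : ∀ ω ∈ A, ω ∈ B) :
    prob μ A ≤ prob μ B :=
  sum_le_sum_of_subset_of_nonneg (monotone_filter_right _ fun ω _ hω => h ω hω) fun ω _ _ => hμ ω

theorem prob_union_le (hμ : ∀ ω, 0 ≤ μ ω) (A B : Set Ω) :
    prob μ (A ∪ B) ≤ prob μ A + prob μ B := by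
  classical
  simp only [prob_eq_sum_ite, ← sum_add_distrib]
  refine sum_le_sum fun ω _ => ?_
  have := hμ ω
  by_cases h1 : ω ∈ A <;> by_cases h2 : ω ∈ B <;> simp [h1, h2, this]

theorem prob_le_sum_mul (hμ : ∀ ω, 0 ≤ μ ω) {A : Set Ω} {φ : Ω → ℝ} (h0 : ∀ ω, 0 ≤ φ ω)
    (h1 : ∀ ω ∈ A, 1 ≤ φ ω) : prob μ A ≤ ∑ ω, μ ω * φ ω := by
  classical
  rw [prob_eq_sum_ite]
  refine sum_le_sum fun ω _ => ?_
  split_ifs with h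
  · exact le_mul_of_one_le_right (hμ ω) (h1 ω h)
  · exact mul_nonneg (hμ ω) (h0 ω)

theorem le_prob (hμ : ∀ ω, 0 ≤ μ ω) {A : Set Ω} {ω : Ω} (h : ω ∈ A) : μ ω ≤ prob μ A := by
  classical
  exact single_le_sum (f := μ) (fun ω _ => hμ ω) (by simpa using h)

theorem prob_add_compl (μ : Ω → ℝ) (A : Set Ω) : prob μ A + prob μ Aᶜ = ∑ ω, μ ω := by
  classical
  simp only [prob_eq_sum_ite, ← sum_add_distrib]
  refine sum_congr rfl fun ω _ => ?_
  by_cases h : ω ∈ A <;> simp [h]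

open Classical in
/-- Grouping outcomes by the values of two random variables. -/
theorem sum_prob_mul (μ : Ω → ℝ) (U : Ω → α) (V : Ω → β) (F : α → β → ℝ) :
    ∑ u ∈ univ.image U, ∑ v ∈ univ.image V, prob μ {ω | U ω = u ∧ V ω = v} * F u v
      = ∑ ω, μ ω * F (U ω) (V ω) := by
  rw [← sum_fiberwise_of_maps_to (g := U) (t := univ.image U) (by simp)]
  refine sum_congr rfl fun u _ => ?_
  rw [← sum_fiberwise_of_maps_to (g := V) (t := univ.image V) (by simp)]
  refine sum_congr rfl fun v _ => ?_
  rw [prob, sum_mul, filter_filter]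
  refine sum_congr (by ext; simp) fun ω hω => ?_
  simp only [mem_filter, mem_univ, true_and] at hω
  rw [hω.1, hω.2]

open Classical in
theorem sum_prob_and (μ : Ω → ℝ) (U : Ω → α) (A : Set Ω) {s : Finset α} (hs : ∀ ω, U ω ∈ s) :
    ∑ u ∈ s, prob μ {ω | U ω = u ∧ ω ∈ A} = prob μ A := by
  simp only [prob_eq_sum_ite, Set.mem_ofPred_eq]
  rw [sum_comm]
  refine sum_congr rfl fun ω _ => ?_
  by_cases h : ω ∈ A <;> simp [h, hs]

/-- `I(U;V)` as an expected log-likelihood ratio. -/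
theorem mutualInfo_eq_sum (μ : Ω → ℝ) (U : Ω → α) (V : Ω → β) :
    mutualInfo μ U V = ∑ ω, μ ω * Real.logb 2 (prob μ {ω' | U ω' = U ω ∧ V ω' = V ω} /
        (prob μ {ω' | U ω' = U ω} * prob μ {ω' | V ω' = V ω})) := by
  rw [mutualInfo]
  exact sum_prob_mul μ U V fun u v => Real.logb 2 (prob μ {ω | U ω = u ∧ V ω = v} /
        (prob μ {ω | U ω = u} * prob μ {ω | V ω = v}))

/-- The inequality `1 - 1/t ≤ log t` at `t = a / (b g)`. Summed over a joint law `a` and a product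
law `b`, it bounds mutual information below by any test weight `g`. -/
theorem mul_log_div_ge {a b g : ℝ} (ha : 0 ≤ a) (hb : 0 ≤ b) (hg : 0 < g) (hab : b = 0 → a = 0) :
    a * Real.log g + a - g * b ≤ a * Real.log (a / b) := by
  rcases ha.eq_or_lt with rfl | ha
  · simp; positivity
  have hb' : 0 < b := hb.lt_of_ne fun h => ha.ne' (hab h.symm)
  have h := Real.one_sub_inv_le_log_of_pos (x := a / b / g) (by positivity)
  rw [Real.log_div (by positivity) hg.ne'] at h
  have h2 := mul_le_mul_of_nonneg_left h ha.le
  have : a * (1 - (a / b / g)⁻¹) = a - g * b := by field_simp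
  linarith

/-- If `U` lies with high probability in a small list that depends on `V`, then `I(U;V)` is
large. -/
theorem list_decoding_le_mutualInfo (hμ : ∀ ω, 0 ≤ μ ω) (h1 : ∑ ω, μ ω = 1) (U : Ω → α) (V : Ω → β)
    {K t ℓ : ℝ} (hK : 1 ≤ K) (ht : 0 ≤ t) (hU : ∀ u, prob μ {ω | U ω = u} ≤ t)
    (L : β → Finset α) (hL : ∀ v, (#(L v) : ℝ) ≤ ℓ) :
    prob μ {ω | U ω ∈ L (V ω)} * Real.log K - K * (ℓ * t) ≤ mutualInfo μ U V * Real.log 2 := by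
  classical
  have hl2 : 0 < Real.log 2 := Real.log_pos one_lt_two
  -- The test weight rewards pairs on the list by the factor `K`.
  let g : α → β → ℝ := fun u v => if u ∈ L v then K else 1
  have hg : ∀ u v, 0 < g u v := fun u v => by simp only [g]; split_ifs <;> linarith
  have hmain : ∑ u ∈ univ.image U, ∑ v ∈ univ.image V,
      (prob μ {ω | U ω = u ∧ V ω = v} * Real.log (g u v) + prob μ {ω | U ω = u ∧ V ω = v} * 1
        - g u v * (prob μ {ω | U ω = u} * prob μ {ω | V ω = v})) ≤ mutualInfo μ U V * Real.log 2 := by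
    rw [mutualInfo, sum_mul]
    refine sum_le_sum fun u _ => ?_
    rw [sum_mul]
    refine sum_le_sum fun v _ => ?_
    rw [mul_assoc, Real.logb, div_mul_cancel₀ _ hl2.ne', mul_one]
    refine mul_log_div_ge (prob_nonneg hμ _) (mul_nonneg (prob_nonneg hμ _) (prob_nonneg hμ _))
      (hg u v) fun h => le_antisymm ?_ (prob_nonneg hμ _)
    rcases mul_eq_zero.1 h with h | h
    · rw [← h]; exact prob_mono hμ fun ω hω => hω.1
    · rw [← h]; exact prob_mono hμ fun ω hω => hω.2
  refine le_trans ?_ hmain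
  simp only [sum_sub_distrib, sum_add_distrib]
  rw [sum_prob_mul μ U V fun u v => Real.log (g u v), sum_prob_mul μ U V fun _ _ => (1 : ℝ)]
  have e1 : ∑ ω, μ ω * Real.log (g (U ω) (V ω)) = prob μ {ω | U ω ∈ L (V ω)} * Real.log K := by
    rw [prob_eq_sum_ite, sum_mul]
    refine sum_congr rfl fun ω _ => ?_
    simp only [g, Set.mem_ofPred_eq]
    split_ifs <;> simp
  have eV : ∑ v ∈ univ.image V, prob μ {ω | V ω = v} = 1 := by
    have := sum_prob_and μ V Set.univ (s := univ.image V) (by simp)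
    simpa [prob, h1] using this
  have eU : ∑ u ∈ univ.image U, prob μ {ω | U ω = u} = 1 := by
    have := sum_prob_and μ U Set.univ (s := univ.image U) (by simp)
    simpa [prob, h1] using this
  -- Under the product law a list has mass at most `ℓ t`, so the reward raises the total weight by
  -- at most `K ℓ t`.
  have e3 : ∑ u ∈ univ.image U, ∑ v ∈ univ.image V,
      g u v * (prob μ {ω | U ω = u} * prob μ {ω | V ω = v}) ≤ 1 + K * (ℓ * t) := by
    calc _ ≤ ∑ u ∈ univ.image U, ∑ v ∈ univ.image V,
          (prob μ {ω | U ω = u} * prob μ {ω | V ω = v} +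
            (if u ∈ L v then K * (t * prob μ {ω | V ω = v}) else 0)) := by
          refine sum_le_sum fun u _ => sum_le_sum fun v _ => ?_
          have hu0 := prob_nonneg hμ {ω | U ω = u}
          have hv0 := prob_nonneg hμ {ω | V ω = v}
          have := mul_le_mul_of_nonneg_left (mul_le_mul_of_nonneg_right (hU u) hv0)
            (by linarith : (0 : ℝ) ≤ K)
          simp only [g]
          split_ifs
          · nlinarith [mul_nonneg hu0 hv0]
          · simp
      _ = 1 + ∑ v ∈ univ.image V, ∑ u ∈ univ.image U,
            (if u ∈ L v then K * (t * prob μ {ω | V ω = v}) else 0) := by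
          simp only [sum_add_distrib, ← mul_sum, eV, eU, mul_one]
          rw [sum_comm]
      _ ≤ 1 + ∑ v ∈ univ.image V, K * (ℓ * t) * prob μ {ω | V ω = v} := by
          gcongr with v _
          have hv0 := prob_nonneg hμ {ω | V ω = v}
          rw [← sum_filter, sum_const, nsmul_eq_mul]
          have hc : (#{u ∈ univ.image U | u ∈ L v} : ℝ) ≤ ℓ :=
            le_trans (by exact_mod_cast card_le_card fun u hu => (mem_filter.1 hu).2) (hL v)
          have := mul_le_mul_of_nonneg_right hc
            (mul_nonneg (by linarith : (0 : ℝ) ≤ K) (mul_nonneg ht hv0))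
          linarith
      _ = 1 + K * (ℓ * t) := by rw [← mul_sum, eV, mul_one]
  rw [e1]
  simp only [mul_one, h1]
  linarith

/-- Upper bound on `I(U;V)` for uniform `U`, when `V` is a function of `V'`: outside the event `B`
the divergence from uniform is bounded by a second-moment quantity `G`, and `B` contributes at most
`P(B) log₂ N`. -/
theorem mutualInfo_le_of_collision [Fintype α] [Fintype β'] (hμ : ∀ ω, 0 ≤ μ ω) (U : Ω → α)
    (V : Ω → β) (V' : Ω → β') (f : β' → β) (hf : ∀ ω, V ω = f (V' ω)) {N : ℝ} (hN : 1 ≤ N)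
    (hU : ∀ u, prob μ {ω | U ω = u} = 1 / N) (B : Set Ω) :
    mutualInfo μ U V * Real.log 2 ≤ prob μ B * Real.log N +
      ∑ v, (N * (∑ u, prob μ {ω | U ω = u ∧ V' ω = v ∧ ω ∉ B} ^ 2) /
          (∑ u, prob μ {ω | U ω = u ∧ V' ω = v ∧ ω ∉ B})
        - ∑ u, prob μ {ω | U ω = u ∧ V' ω = v ∧ ω ∉ B}) := by
  classical
  have hl2 : 0 < Real.log 2 := Real.log_pos one_lt_two
  have hN0 : 0 < N := by linarith
  set G : α → β' → ℝ := fun u v => prob μ {ω | U ω = u ∧ V' ω = v ∧ ω ∉ B} with hG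
  set P : α → β → ℝ := fun u v => prob μ {ω | U ω = u ∧ V ω = v} with hP
  set Q : β → ℝ := fun v => prob μ {ω | V ω = v} with hQ
  have G0 : ∀ u v, 0 ≤ G u v := fun u v => prob_nonneg hμ _
  have P0 : ∀ u v, 0 ≤ P u v := fun u v => prob_nonneg hμ _
  have Q0 : ∀ v, 0 ≤ Q v := fun v => prob_nonneg hμ _
  have PQ : ∀ u v, P u v ≤ Q v := fun u v => prob_mono hμ fun ω hω => hω.2
  have sumP : ∀ v, ∑ u, P u v = Q v := fun v => sum_prob_and μ U {ω | V ω = v} (by simp)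
  -- Off `B`, the ratio `N P / Q` is split into `N G / ∑ G`, which yields the collision term, and
  -- the correction `(P / Q) (∑ G / G)`; `log x ≤ x - 1` is applied to each. On `B` the bound `P ≤
  -- Q` leaves `log N`.
  have key : ∀ ω, μ ω * Real.log (N * (P (U ω) (V ω) / Q (V ω))) ≤
      (if ω ∈ B then μ ω * Real.log N else 0) +
      (if ω ∉ B then μ ω else 0) * (N * (G (U ω) (V' ω) / ∑ u, G u (V' ω)) - 1 +
        (P (U ω) (f (V' ω)) / Q (f (V' ω)) * ((∑ u, G u (V' ω)) / G (U ω) (V' ω)) - 1)) := by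
    intro ω
    rcases (hμ ω).eq_or_lt with h0 | h0
    · simp [← h0]
    have hPpos : 0 < P (U ω) (V ω) := h0.trans_le (le_prob hμ ⟨rfl, rfl⟩)
    have hQpos : 0 < Q (V ω) := h0.trans_le (le_prob hμ rfl)
    by_cases hB : ω ∈ B
    · simp only [hB, if_true, not_true_eq_false, if_false, zero_mul, add_zero]
      refine mul_le_mul_of_nonneg_left (Real.log_le_log (by positivity) ?_) h0.le
      have : P (U ω) (V ω) / Q (V ω) ≤ 1 := div_le_one_of_le₀ (PQ _ _) hQpos.le
      nlinarith
    · simp only [hB, if_false, not_false_eq_true, if_true, zero_add]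
      refine mul_le_mul_of_nonneg_left ?_ h0.le
      rw [← hf ω]
      have hGpos : 0 < G (U ω) (V' ω) := h0.trans_le (le_prob hμ ⟨rfl, rfl, hB⟩)
      have hGs : 0 < ∑ u, G u (V' ω) :=
        hGpos.trans_le (single_le_sum (f := fun u => G u (V' ω)) (fun u _ => G0 u _) (mem_univ _))
      have e : N * (P (U ω) (V ω) / Q (V ω)) = (N * (G (U ω) (V' ω) / ∑ u, G u (V' ω))) *
          (P (U ω) (V ω) / Q (V ω) * ((∑ u, G u (V' ω)) / G (U ω) (V' ω))) := by field_simp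
      rw [e, Real.log_mul (by positivity) (by positivity)]
      exact add_le_add (Real.log_le_sub_one_of_pos (by positivity))
        (Real.log_le_sub_one_of_pos (by positivity))
  have hI : mutualInfo μ U V * Real.log 2 = ∑ ω, μ ω * Real.log (N * (P (U ω) (V ω) / Q (V ω))) := by
    rw [mutualInfo_eq_sum, sum_mul]
    refine sum_congr rfl fun ω _ => ?_
    rw [mul_assoc, Real.logb, div_mul_cancel₀ _ hl2.ne', hU]
    congr 2
    simp only [hP, hQ]
    field_simp
  have regroup : ∀ F : α → β' → ℝ, ∑ ω, (if ω ∉ B then μ ω else 0) * F (U ω) (V' ω)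
      = ∑ v, ∑ u, G u v * F u v := by
    intro F
    have : ∀ u v, G u v * F u v =
        ∑ ω, if U ω = u then (if V' ω = v then (if ω ∉ B then μ ω else 0) * F u v else 0) else 0 := by
      intro u v
      simp only [hG]
      rw [prob_eq_sum_ite, sum_mul]
      refine sum_congr rfl fun ω _ => ?_
      by_cases a : U ω = u <;> by_cases b : V' ω = v <;> simp [a, b]
    simp only [this]
    rw [sum_congr rfl fun v _ => sum_comm, sum_comm]
    refine sum_congr rfl fun ω _ => ?_
    simp
  rw [hI]
  refine (sum_le_sum fun ω _ => key ω).trans ?_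
  rw [sum_add_distrib]
  refine add_le_add ?_ ?_
  · rw [prob_eq_sum_ite, sum_mul]
    exact (sum_congr rfl fun ω _ => by split_ifs <;> simp).le
  · rw [regroup fun u v => N * (G u v / ∑ u, G u v) - 1 +
        (P u (f v) / Q (f v) * ((∑ u, G u v) / G u v) - 1)]
    refine sum_le_sum fun v _ => ?_
    have e1 : ∑ u, G u v * (N * (G u v / ∑ u, G u v) - 1 +
        (P u (f v) / Q (f v) * ((∑ u, G u v) / G u v) - 1)) =
        (N * (∑ u, G u v ^ 2) / (∑ u, G u v) - ∑ u, G u v) +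
        (∑ u, P u (f v) / Q (f v) * ((∑ u, G u v) * (G u v / G u v)) - ∑ u, G u v) := by
      rw [mul_sum, sum_div, ← sum_sub_distrib, ← sum_sub_distrib, ← sum_add_distrib]
      refine sum_congr rfl fun u _ => ?_
      ring
    rw [e1]
    -- The correction terms sum to at most `0` because the conditional law `P / Q` has total mass at
    -- most `1`; where `G` or `Q` vanishes, `0 / 0 = 0` only helps.
    refine add_le_of_nonpos_right (sub_nonpos.2 ?_)
    have hs0 : 0 ≤ ∑ u, G u v := sum_nonneg fun u _ => G0 u v
    calc _ ≤ ∑ u, P u (f v) / Q (f v) * (∑ u, G u v) := by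
          refine sum_le_sum fun u _ => mul_le_mul_of_nonneg_left
            (mul_le_of_le_one_right hs0 (div_self_le_one _)) (div_nonneg (P0 _ _) (Q0 _))
      _ = (Q (f v) / Q (f v)) * ∑ u, G u v := by rw [← sum_mul, ← sum_div, sumP]
      _ ≤ _ := mul_le_of_le_one_left hs0 (div_self_le_one _)

end Probability

/-! ### Random functions -/

/-- Adding `t` to the value at `x'` is a bijection from the functions that collide at `x, x'` onto
those with `S x' - S x = t`; hence all fibres of this difference have equal size. -/
theorem card_mul_card_collision {X A : Type*} [Fintype X] [DecidableEq X] [Fintype A]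
    [DecidableEq A] [AddCommGroup A] {x x' : X} (h : x ≠ x') :
    Fintype.card A * #{S : X → A | S x = S x'} = Fintype.card (X → A) := by
  have h1 : ∀ t : A, #{S : X → A | S x = S x'} = #{S : X → A | S x' - S x = t} := by
    intro t
    refine card_equiv (Equiv.addRight (Pi.single x' t)) fun S => ?_
    simp only [mem_filter, mem_univ, true_and, Equiv.coe_addRight, Pi.add_apply, Pi.single_eq_same,
      Pi.single_eq_of_ne h, add_zero]
    rw [sub_eq_iff_eq_add, add_comm t, add_left_inj, eq_comm]
  have h2 := card_eq_sum_card_fiberwise (f := fun S : X → A => S x' - S x) (s := univ) (t := univ)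
    (by simp)
  rw [← Finset.card_univ (α := X → A), h2, ← sum_congr rfl fun t _ => h1 t]
  simp

/-- Leftover hashing: if `b x` (`≤ m`) is the mass of `x`, `S` is a uniformly random function and
`D = c + S x` for uniform `c`, then given `(S, D)` the posterior of `c` is nearly uniform. -/
theorem leftover_hash {X A : Type*} [Fintype X] [DecidableEq X] [Fintype A] [DecidableEq A]
    [AddCommGroup A] {b : X → ℝ} {m : ℝ} (hb : ∀ x, 0 ≤ b x) (hm : ∀ x, b x ≤ m) (hm0 : 0 ≤ m) :
    ∑ S : X → A, ∑ D : A, ((Fintype.card A : ℝ) *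
        (∑ c, (∑ x, if c + S x = D then b x else 0) ^ 2) /
          (∑ c, ∑ x, if c + S x = D then b x else 0)
        - ∑ c, ∑ x, if c + S x = D then b x else 0)
      ≤ Fintype.card (X → A) * (Fintype.card A) ^ 2 * m := by
  have hs : ∀ (S : X → A) (D : A), ∑ c, ∑ x, (if c + S x = D then b x else 0) = ∑ x, b x := by
    intro S D
    rw [sum_comm]
    refine sum_congr rfl fun x _ => ?_
    simp [← eq_sub_iff_add_eq]
  -- For given `S` and `D` each `x` fits exactly one `c`, so the second moment counts the pairs on
  -- which `S` collides.
  have hsq : ∀ (S : X → A) (D : A), ∑ c, (∑ x, if c + S x = D then b x else 0) ^ 2 =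
      ∑ x, ∑ x', if S x = S x' then b x * b x' else 0 := by
    intro S D
    simp only [sq, sum_mul_sum]
    rw [sum_comm]
    refine sum_congr rfl fun x _ => ?_
    rw [sum_comm]
    refine sum_congr rfl fun x' _ => ?_
    simp only [← eq_sub_iff_add_eq, ite_mul, zero_mul, mul_ite, mul_zero, sum_ite_eq', mem_univ,
      if_true]
    simp [eq_comm]
  simp only [hs, hsq]
  set a := ∑ x, b x with ha
  have ha0 : 0 ≤ a := sum_nonneg fun x _ => hb x
  have hc0 : (0 : ℝ) ≤ Fintype.card A := Nat.cast_nonneg _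
  set k : ℝ := (Fintype.card A : ℝ) with hk
  set T : ℝ := (Fintype.card (X → A) : ℝ) with hT
  have hT0 : 0 ≤ T := Nat.cast_nonneg _
  -- The diagonal is controlled by `b ≤ m`. Off the diagonal a pair collides for a fraction `1/k` of
  -- the functions, which gives just the contribution `T a²` of a uniform posterior; it cancels
  -- against the subtracted mass below.
  have hcount : ∑ S : X → A, ∑ x, ∑ x', (if S x = S x' then b x * b x' else 0) * k
      ≤ T * k * (m * a) + T * (a * a) := by
    rw [sum_comm]
    have : ∀ x, ∑ S : X → A, ∑ x', (if S x = S x' then b x * b x' else 0) * k ≤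
        T * k * (m * b x) + T * (b x * a) := by
      intro x
      rw [sum_comm, ha, mul_sum, mul_sum]
      calc _ ≤ ∑ x', ((if x' = x then T * k * (m * b x) else 0) + T * (b x * b x')) := by
            refine sum_le_sum fun x' _ => ?_
            rw [← sum_mul, ← sum_filter, sum_const, nsmul_eq_mul]
            split_ifs with h
            · subst h
              have h1 : (#{S : X → A | S x' = S x'} : ℝ) = T := by simp [hT]
              rw [h1]
              have h2 := mul_le_mul_of_nonneg_left
                (mul_le_mul_of_nonneg_right (hm x') (hb x')) (mul_nonneg hT0 hc0)
              have h3 := mul_nonneg hT0 (mul_nonneg (hb x') (hb x'))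
              linarith
            · have h1 := card_mul_card_collision (A := A) (Ne.symm h)
              have h2 : k * (#{S : X → A | S x = S x'} : ℝ) = T := by
                rw [hk, hT]; exact_mod_cast h1
              rw [← h2]
              apply le_of_eq; ring
        _ = _ := by simp [sum_add_distrib]
    refine (sum_le_sum fun x _ => this x).trans ?_
    rw [sum_add_distrib, ← mul_sum, ← mul_sum, ← mul_sum, ← sum_mul]
  rcases ha0.eq_or_lt with h0 | h0
  · rw [← h0]
    simp
    positivity
  simp only [sum_const, card_univ, nsmul_eq_mul, ← hk]
  rw [← mul_sum, sum_sub_distrib, ← sum_div, ← mul_sum, sum_const, card_univ, nsmul_eq_mul, ← hT]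
  have h4 : k * ∑ S : X → A, ∑ x, ∑ x', (if S x = S x' then b x * b x' else 0)
      ≤ T * k * (m * a) + T * (a * a) := by
    refine le_of_eq_of_le ?_ hcount
    simp only [mul_sum, mul_comm]
  have h5 : (k * ∑ S : X → A, ∑ x, ∑ x', (if S x = S x' then b x * b x' else 0)) / a
      ≤ T * k * m + T * a := by
    rw [div_le_iff₀ h0]; linarith
  have h6 := mul_le_mul_of_nonneg_left h5 hc0
  nlinarith

/-! ### The degraded channel -/

theorem PMF.sum_toReal {A : Type*} [Fintype A] (f : PMF A) : ∑ a, (f a).toReal = 1 := by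
  rw [← ENNReal.toReal_sum fun a _ => f.apply_ne_top a, ← tsum_fintype (L := .unconditional _),
    f.tsum_coe, ENNReal.toReal_one]

/-- A degraded channel is a binary symmetric channel to Bob followed by a channel to Eve. -/
theorem IsDegradedBSBC.exists_factor {W : WiretapChannel Bool Bool Bool} {p q : ℝ}
    (hW : IsDegradedBSBC W p q) : ∃ v : Bool → Bool → ℝ, (∀ y z, 0 ≤ v y z) ∧
      (∀ y, ∑ z, v y z = 1) ∧ ∀ x y z, (W x (y, z)).toReal = noiseBit p (xor x y) * v y z := by
  obtain ⟨V, hV⟩ := hW.degraded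
  refine ⟨fun y z => (V y z).toReal, fun _ _ => ENNReal.toReal_nonneg, fun y => PMF.sum_toReal _,
    fun x y z => ?_⟩
  rw [hV, ENNReal.toReal_mul, hW.bob]
  cases x <;> cases y <;> simp [noiseBit]

/-! ### Transcripts -/

section Transcript

variable {Msg : Type}

theorem length_exchange (a b : List Msg → Msg) (r : ℕ) (t : List Msg) :
    (exchange a b r t).length = t.length + 2 * r := by
  induction r generalizing t with
  | zero => rfl
  | succ r ih => rw [exchange, ih]; simp; ring

/-- Each message depends only on its sender's rule and the common past. When two runs agree, the two
rules of Bob have produced the same messages along them, and one may replace the other. Equal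
lengths let the concatenations be split. -/
theorem exchange_rectangle {a b a' b' : List Msg → Msg} {r : ℕ} {t t' : List Msg}
    (hl : t.length = t'.length) (h : exchange a b r t = exchange a' b' r t') :
    t = t' ∧ exchange a b' r t = exchange a b r t := by
  induction r generalizing t t' with
  | zero => exact ⟨h, rfl⟩
  | succ r ih =>
    rw [exchange, exchange] at h
    obtain ⟨h1, h2⟩ := ih (by simp [hl]) h
    obtain ⟨h3, h4⟩ := List.append_inj' h1 rfl
    obtain ⟨h5, -⟩ := List.append_inj' h3 rfl
    refine ⟨h5, ?_⟩
    rw [exchange, exchange]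
    have h6 : b (t ++ [a t]) = b' (t ++ [a t]) := by
      rw [h3]; rw [h3] at h4; simpa using h4
    rw [← h6, h2]

variable {n : ℕ} {rounds : ℕ → ℕ}

theorem length_transcriptAt (a : List Msg → Msg) (b : List Bool → List Msg → Msg)
    (y : Fin n → Bool) (i : ℕ) :
    (transcriptAt rounds a b y i).length = 2 * ∑ j ∈ range (i + 1), rounds j := by
  induction i with
  | zero => simp [transcriptAt, length_exchange]
  | succ i ih => rw [transcriptAt, length_exchange, ih, sum_range_succ _ (i + 1)]; ring

/-- The pairs of behaviours of Alice and Bob that lead to a given transcript form a rectangle. -/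
theorem transcriptAt_rectangle {a a' : List Msg → Msg} {b b' : List Bool → List Msg → Msg}
    {y y' : Fin n → Bool} {i : ℕ}
    (h : transcriptAt rounds a b y i = transcriptAt rounds a' b' y' i) :
    ∀ j ≤ i, transcriptAt rounds a b' y' j = transcriptAt rounds a b y j := by
  induction i with
  | zero =>
    intro j hj
    obtain rfl := Nat.le_zero.1 hj
    exact (exchange_rectangle rfl h).2
  | succ i ih =>
    intro j hj
    rw [transcriptAt, transcriptAt] at h
    obtain ⟨h1, h2⟩ := exchange_rectangle (by rw [length_transcriptAt, length_transcriptAt]) h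
    rcases hj.lt_or_eq with hj | rfl
    · exact ih h1 j (Nat.lt_succ_iff.1 hj)
    · rw [transcriptAt, transcriptAt, ih h1 i le_rfl, h2]

/-- Causality: in stage `i` Bob holds only the outputs with index below `i`, so the input chosen at
the end of that stage cannot depend on output `i`. This is what keeps the noise independent despite
feedback. -/
theorem transcriptAt_congr (a : List Msg → Msg) (b : List Bool → List Msg → Msg)
    {y y' : Fin n → Bool} {i : ℕ} (h : ∀ j : Fin n, (j : ℕ) < i → y j = y' j) :
    transcriptAt rounds a b y i = transcriptAt rounds a b y' i := by
  induction i with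
  | zero => rfl
  | succ i ih =>
    have : (List.ofFn y).take (i + 1) = (List.ofFn y').take (i + 1) := by
      refine List.ext_getElem (by simp) fun j h1 h2 => ?_
      simp only [List.length_take, List.length_ofFn, lt_min_iff] at h1
      simpa using h ⟨j, h1.2⟩ h1.1
    rw [transcriptAt, transcriptAt, this, ih fun j hj => h j (hj.trans (Nat.lt_succ_self i))]

/-- Two rounds after the last channel use, and no others. -/
def finalRounds (n i : ℕ) : ℕ := if i = n then 2 else 0

theorem transcriptAt_finalRounds_lt (a : List Msg → Msg) (b : List Bool → List Msg → Msg)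
    (y : Fin n → Bool) {i : ℕ} (hi : i < n) : transcriptAt (finalRounds n) a b y i = [] := by
  induction i with
  | zero => rw [transcriptAt, finalRounds, if_neg hi.ne, exchange]
  | succ i ih => rw [transcriptAt, ih (by omega), finalRounds, if_neg hi.ne, exchange]

theorem transcriptAt_finalRounds (a : List Msg → Msg) (b : List Bool → List Msg → Msg)
    (y : Fin n → Bool) :
    transcriptAt (finalRounds n) a b y n = exchange a (b (List.ofFn y)) 2 [] := by
  cases n with
  | zero => simp [transcriptAt, finalRounds]
  | succ i =>
    rw [transcriptAt, transcriptAt_finalRounds_lt _ _ _ (Nat.lt_succ_self i), finalRounds,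
      if_pos rfl, List.take_of_length_le (by simp)]

theorem exchange_two (a b : List Msg → Msg) :
    exchange a b 2 [] = [a [], b [a []], a [a [], b [a []]],
      b [a [], b [a []], a [a [], b [a []]]]] := rfl

end Transcript

/-! ### The experiment -/

/-- Adding a word whose `i`-th letter depends only on the previous letters is injective. -/
theorem bijective_bxor_of_causal {n : ℕ} {f : (Fin n → Bool) → Fin n → Bool}
    (hf : ∀ y y' i, (∀ j < i, y j = y' j) → f y i = f y' i) :
    Function.Bijective fun y => bxor (f y) y := by
  refine Finite.injective_iff_bijective.1 fun y y' h => ?_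
  have : ∀ k : ℕ, ∀ i : Fin n, (i : ℕ) = k → y i = y' i := by
    intro k
    induction k using Nat.strong_induction_on with
    | _ k ih =>
      intro i hi
      have h1 := congrFun h i
      have h2 := hf y y' i fun j hj => ih j (hi ▸ hj) j rfl
      simpa [bxor, h2] using h1
  funext i
  exact this i i rfl

section Experiment

variable {N n : ℕ} {Msg : Type} {W : WiretapChannel Bool Bool Bool} {rounds : ℕ → ℕ}
  {a : AliceStrategy N n Msg} {b : BobStrategy Msg} {p : ℝ} {v : Bool → Bool → ℝ}

theorem law_nonneg (ω : Outcome a b) : 0 ≤ law W rounds a b ω := by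
  unfold law
  have := prod_nonneg fun (i : Fin n) (_ : i ∈ univ) => ENNReal.toReal_nonneg
    (a := W (channelInput rounds ω i) (bobOutput ω i, eveOutput ω i))
  positivity

theorem law_eq (hv : ∀ x y z, (W x (y, z)).toReal = noiseBit p (xor x y) * v y z)
    (ω : Outcome a b) : law W rounds a b ω = (1 / (N : ℝ)) * (a.keyLaw ω.2.1).toReal *
      (b.keyLaw ω.2.2.1).toReal * (noiseLaw p (bxor (channelInput rounds ω) (bobOutput ω)) *
        ∏ i, v (bobOutput ω i) (eveOutput ω i)) := by
  unfold law noiseLaw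
  rw [← prod_mul_distrib]
  simp only [hv, bxor]

/-- The channel noise is independent of the commit string and of the keys, even if the inputs
depend on the previous outputs. -/
theorem sum_law_mul (hv : ∀ x y z, (W x (y, z)).toReal = noiseBit p (xor x y) * v y z)
    (hv1 : ∀ y, ∑ z, v y z = 1) (φ : Fin N → a.Key → b.Key → (Fin n → Bool) → ℝ) :
    ∑ ω : Outcome a b, law W rounds a b ω *
        φ ω.1 ω.2.1 ω.2.2.1 (bxor (channelInput rounds ω) (bobOutput ω)) =
      ∑ c, ∑ ka, ∑ kb, (1 / (N : ℝ)) * (a.keyLaw ka).toReal * (b.keyLaw kb).toReal *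
        ∑ e, noiseLaw p e * φ c ka kb e := by
  simp only [Fintype.sum_prod_type]
  refine sum_congr rfl fun c _ => sum_congr rfl fun ka _ => sum_congr rfl fun kb _ => ?_
  let X : (Fin n → Bool) → Fin n → Bool := fun y i =>
    a.input c ka i (transcriptAt rounds (a.msg c ka) (b.msg kb) y i)
  have hX : ∀ y y' i, (∀ j < i, y j = y' j) → X y i = X y' i := fun y y' i h => by
    simp only [X]
    rw [transcriptAt_congr _ _ h]
  -- With the commit string and keys fixed, outputs correspond bijectively to noise vectors, so the
  -- sum may run over the noise; Eve's outputs then sum to `1`.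
  have hbij := bijective_bxor_of_causal hX
  rw [← hbij.sum_comp fun e => noiseLaw p e * φ c ka kb e, mul_sum]
  refine sum_congr rfl fun y _ => ?_
  have : ∀ z : Fin n → Bool, law W rounds a b ((c, ka, kb, y, z) : Outcome a b) *
      φ c ka kb (bxor (channelInput rounds ((c, ka, kb, y, z) : Outcome a b))
        (bobOutput ((c, ka, kb, y, z) : Outcome a b))) =
      (1 / (N : ℝ)) * (a.keyLaw ka).toReal * (b.keyLaw kb).toReal *
        (noiseLaw p (bxor (X y) y) * φ c ka kb (bxor (X y) y)) * ∏ i, v (y i) (z i) := by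
    intro z
    rw [law_eq hv]
    change (1 / (N : ℝ)) * (a.keyLaw ka).toReal * (b.keyLaw kb).toReal *
      (noiseLaw p (bxor (X y) y) * ∏ i, v (y i) (z i)) * φ c ka kb (bxor (X y) y) = _
    ring
  simp only [this]
  rw [← mul_sum, sum_prod_bits fun i z => v (y i) z]
  simp only [hv1, prod_const_one, mul_one]

theorem sum_law (hN : N ≠ 0) (hv : ∀ x y z, (W x (y, z)).toReal = noiseBit p (xor x y) * v y z)
    (hv1 : ∀ y, ∑ z, v y z = 1) : ∑ ω : Outcome a b, law W rounds a b ω = 1 := by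
  have h := sum_law_mul (rounds := rounds) (a := a) (b := b) hv hv1 fun _ _ _ _ => 1
  simp only [mul_one, sum_noiseLaw, ← mul_sum, PMF.sum_toReal] at h
  rw [h]
  simp [hN]

theorem prob_commitString
    (hv : ∀ x y z, (W x (y, z)).toReal = noiseBit p (xor x y) * v y z)
    (hv1 : ∀ y, ∑ z, v y z = 1) (c : Fin N) :
    prob (law W rounds a b) {ω : Outcome a b | commitString ω = c} = 1 / N := by
  classical
  have h := sum_law_mul (rounds := rounds) (a := a) (b := b) hv hv1
    fun c' _ _ _ => if c' = c then 1 else 0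
  rw [prob_eq_sum_ite]
  refine Eq.trans (sum_congr rfl fun ω _ => ?_) (h.trans ?_)
  · by_cases hc : ω.1 = c <;> simp [commitString, hc]
  · simp [sum_noiseLaw, ← mul_sum, PMF.sum_toReal]

/-- Averaging over all that is independent of the noise. -/
theorem sum_law_mul_le (hN : N ≠ 0)
    (hv : ∀ x y z, (W x (y, z)).toReal = noiseBit p (xor x y) * v y z)
    (hv1 : ∀ y, ∑ z, v y z = 1) {φ : Fin N → a.Key → b.Key → (Fin n → Bool) → ℝ} {t : ℝ}
    (h : ∀ c ka, ∑ kb, (b.keyLaw kb).toReal * ∑ e, noiseLaw p e * φ c ka kb e ≤ t) :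
    ∑ ω : Outcome a b, law W rounds a b ω *
        φ ω.1 ω.2.1 ω.2.2.1 (bxor (channelInput rounds ω) (bobOutput ω)) ≤ t := by
  rw [sum_law_mul hv hv1]
  calc _ = ∑ c : Fin N, ∑ ka, (1 / (N : ℝ)) * (a.keyLaw ka).toReal *
        ∑ kb, (b.keyLaw kb).toReal * ∑ e, noiseLaw p e * φ c ka kb e := by
        simp only [mul_sum, mul_assoc]
    _ ≤ ∑ _c : Fin N, ∑ ka, (1 / (N : ℝ)) * (a.keyLaw ka).toReal * t := by
        gcongr with c _ ka _
        exact h c ka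
    _ = t := by simp [← sum_mul, ← mul_sum, PMF.sum_toReal, hN]

end Experiment

/-! ### The converse -/

/-- If `K` has rectangular fibres, then `a` and `b` are independent given `K (a, b)`, and a label
computed from `K` alone does at least as well as any label `C a`. -/
theorem exists_decoder {A B κ γ : Type*} [Fintype A] [Fintype B] [Finite γ] [Nonempty γ]
    {K : A → B → κ} (hK : ∀ a a' b b', K a b = K a' b' → K a b' = K a b) {u : A → ℝ}
    (hu : ∀ a, 0 ≤ u a) (w : κ → B → ℝ) (C : A → γ) (f : γ → κ → B → ℝ) :
    ∃ D : κ → γ, ∑ a, ∑ b, u a * w (K a b) b * f (D (K a b)) (K a b) b ≤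
      ∑ a, ∑ b, u a * w (K a b) b * f (C a) (K a b) b := by
  classical
  -- The cost of label `c` at `k`. By the rectangle property the `b` compatible with `k` are the
  -- same for every `a` that can reach `k`, so one minimiser serves all of them.
  let F : κ → γ → ℝ := fun k c => ∑ b with ∃ a, K a b = k, w k b * f c k b
  have hmin : ∀ k, ∃ c, ∀ c', F k c ≤ F k c' := fun k => Finite.exists_min (F k)
  choose D hD using hmin
  refine ⟨D, sum_le_sum fun a _ => ?_⟩
  have key : ∀ E : κ → γ, ∑ b, u a * w (K a b) b * f (E (K a b)) (K a b) b =
      ∑ k ∈ univ.image (K a), u a * F k (E k) := by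
    intro E
    rw [← sum_fiberwise_of_maps_to (g := K a) (t := univ.image (K a)) (by simp)]
    refine sum_congr rfl fun k hk => ?_
    obtain ⟨b₀, -, rfl⟩ := mem_image.1 hk
    rw [mul_sum]
    refine sum_congr (filter_congr fun b _ => ⟨fun h => ⟨a, h⟩, fun ⟨a', h⟩ =>
      hK a a' b₀ b h.symm⟩) fun b hb => ?_
    obtain ⟨a', h⟩ := (mem_filter.1 hb).2
    rw [hK a a' b₀ b h.symm, mul_assoc]
  rw [key D]
  refine (sum_le_sum fun k _ => mul_le_mul_of_nonneg_left (hD k (C a)) (hu a)).trans ?_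
  rw [key fun _ => C a]

/-- In a sound and binding protocol the commit string is, up to a small error, a function of the
channel inputs and the transcript. -/
theorem CommitmentProtocol.exists_decoder {N n : ℕ} [NeZero N] (P : CommitmentProtocol N n)
    {W : WiretapChannel Bool Bool Bool} {ε : ℝ} (hs : P.IsSound W ε) (hb : P.IsOneBinding W ε) :
    ∃ D : (Fin n → Bool) → List P.Msg → Fin N,
      prob (law W P.rounds P.alice P.bob)
        {ω | commitString ω ≠ D (channelInput P.rounds ω) (transcript P.rounds ω)} ≤ 3 * ε := by
  classical
  let K : Fin N × P.alice.Key → P.bob.Key × (Fin n → Bool) × (Fin n → Bool) →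
      (Fin n → Bool) × List P.Msg := fun a b =>
    (channelInput P.rounds ((a.1, a.2, b) : Outcome P.alice P.bob),
      transcript P.rounds ((a.1, a.2, b) : Outcome P.alice P.bob))
  have hK : ∀ a a' b b', K a b = K a' b' → K a b' = K a b := by
    intro a a' b b' h
    -- The intermediate transcripts agree too, which is needed because the inputs are computed from
    -- them.
    have h1 := transcriptAt_rectangle (congrArg Prod.snd h)
    refine Prod.ext (funext fun i => ?_) (h1 n le_rfl)
    exact congrArg (P.alice.input a.1 a.2 i) (h1 i i.2.le)
  obtain ⟨D, hD⟩ := WiretapCommitment.exists_decoder hK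
    (u := fun a => (1 / (N : ℝ)) * (P.alice.keyLaw a.2).toReal) (fun a => by positivity)
    (fun k b => (P.bob.keyLaw b.1).toReal * ∏ i, (W (k.1 i) (b.2.1 i, b.2.2 i)).toReal)
    (fun a => a.1) (fun c k b => if P.test c k.1 (b.1, b.2.1, k.2) ≠ true then 1 else 0)
  have conv : ∀ E : Fin N → (Fin n → Bool) × List P.Msg → Fin N,
      ∑ a : Fin N × P.alice.Key, ∑ b : P.bob.Key × (Fin n → Bool) × (Fin n → Bool),
        (1 / (N : ℝ)) * (P.alice.keyLaw a.2).toReal * ((P.bob.keyLaw b.1).toReal *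
          ∏ i, (W ((K a b).1 i) (b.2.1 i, b.2.2 i)).toReal) *
          (if P.test (E a.1 (K a b)) (K a b).1 (b.1, b.2.1, (K a b).2) ≠ true then 1 else 0) =
      prob (law W P.rounds P.alice P.bob)
        {ω | P.test (E ω.1 (channelInput P.rounds ω, transcript P.rounds ω))
          (channelInput P.rounds ω) (bobView P.rounds ω) ≠ true} := by
    intro E
    rw [prob_eq_sum_ite, Fintype.sum_prod_type, Fintype.sum_prod_type]
    refine sum_congr rfl fun c _ => ?_
    rw [Fintype.sum_prod_type]
    refine sum_congr rfl fun ka _ => sum_congr rfl fun b _ => ?_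
    rw [mul_ite, mul_one, mul_zero, ← mul_assoc]
    simp only [Set.mem_ofPred_eq]
    congr 1
  have hDfail := (conv fun _ k => D k).symm.le.trans (hD.trans (conv fun c _ => c).le)
  have hs' : prob (law W P.rounds P.alice P.bob)
    {ω | P.test ω.1 (channelInput P.rounds ω) (bobView P.rounds ω) ≠ true} ≤ ε := hs
  -- The cheater behaves honestly in the commit phase and opens both `C` and `D (X, M)` with the
  -- true word. The three errors `ε` are: both openings accepted, the true one rejected, the decoded
  -- one rejected.
  have hbind := hb P.alice fun v => ((v.1, v.2.2.1), (D (v.2.2.1, v.2.2.2), v.2.2.1))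
  refine ⟨fun x m => D (x, m), ?_⟩
  have hnn := fun ω => law_nonneg (W := W) (rounds := P.rounds) (a := P.alice) (b := P.bob) ω
  refine (prob_mono hnn ?_).trans ((prob_union_le hnn _ _).trans
    (add_le_add ((prob_union_le hnn _ _).trans (add_le_add hbind hs')) (hDfail.trans hs')) |>.trans
      (by linarith))
  intro ω hω
  by_cases h1 : P.test ω.1 (channelInput P.rounds ω) (bobView P.rounds ω) = true
  · by_cases h2 : P.test (D (channelInput P.rounds ω, transcript P.rounds ω))
      (channelInput P.rounds ω) (bobView P.rounds ω) = true
    · exact Or.inl (Or.inl ⟨hω, h1, h2⟩)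
    · exact Or.inr h2
  · exact Or.inl (Or.inr h1)

theorem binaryEntropy_mul_log_two (p : ℝ) :
    binaryEntropy p * Real.log 2 = -p * Real.log p - (1 - p) * Real.log (1 - p) := by
  have : Real.log 2 ≠ 0 := (Real.log_pos one_lt_two).ne'
  simp only [binaryEntropy, Real.logb]
  field_simp

theorem card_ball_le_pow {n : ℕ} (y : Fin n → Bool) (a : ℝ) {c : ℝ} (h0 : 0 < c) (h1 : c ≤ 1) :
    (#{x : Fin n → Bool | (hammingDist x y : ℝ) ≤ n * a} : ℝ) ≤ ((1 + c) * c ^ (-a)) ^ n := by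
  have h := card_ball_mul_le y (n * a) h0 h1
  rw [← le_div_iff₀ (by positivity)] at h
  refine h.trans_eq ?_
  rw [mul_pow, ← Real.rpow_natCast (c ^ _), ← Real.rpow_mul h0.le, div_eq_mul_inv,
    ← Real.rpow_neg h0.le]
  congr 2
  ring

/-- The exponent of the size of a Hamming ball of radius slightly above `n p`. -/
theorem exists_ball_exponent_lt {p R : ℝ} (h0 : 0 < p) (h1 : p < 1 / 2) (hR : binaryEntropy p < R) :
    ∃ δ > 0, ∃ B < (2 : ℝ) ^ R, 0 < B ∧ ∀ (n : ℕ) (y : Fin n → Bool),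
      (#{x : Fin n → Bool | (hammingDist x y : ℝ) ≤ n * (p + δ)} : ℝ) ≤ B ^ n := by
  have hp1 : 0 < 1 - p := by linarith
  -- The optimal parameter in the ball bound: at `δ = 0` the base is exactly `2 ^ H(p)`, and
  -- continuity leaves room for some `δ > 0`. `p < 1/2` gives `c ≤ 1`.
  set c : ℝ := p / (1 - p) with hc
  have hc0 : 0 < c := by positivity
  have hc1 : c ≤ 1 := by rw [hc, div_le_one hp1]; linarith
  have hB0 : (1 + c) * c ^ (-(p + 0)) = (2 : ℝ) ^ binaryEntropy p := by
    refine Real.log_injOn_pos (Set.mem_Ioi.2 (by positivity)) (Set.mem_Ioi.2 (by positivity)) ?_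
    have h1c : 1 + c = (1 - p)⁻¹ := by rw [hc]; field_simp; ring
    rw [Real.log_mul (by positivity) (by positivity), Real.log_rpow hc0, Real.log_rpow two_pos,
      binaryEntropy_mul_log_two, h1c, Real.log_inv, hc, Real.log_div h0.ne' hp1.ne']
    ring
  have hcont : Continuous fun δ : ℝ => (1 + c) * c ^ (-(p + δ)) :=
    continuous_const.mul (continuous_const.rpow (by fun_prop) fun _ => Or.inl hc0.ne')
  have hlt : (1 + c) * c ^ (-(p + 0)) < (2 : ℝ) ^ R := by
    rw [hB0]; exact Real.rpow_lt_rpow_of_exponent_lt one_lt_two hR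
  obtain ⟨δ, hδ, hδ0⟩ := ((((hcont.tendsto 0).eventually (gt_mem_nhds hlt)).filter_mono
    (nhdsWithin_le_nhds (s := Set.Ioi 0))).and self_mem_nhdsWithin).exists
  refine ⟨δ, hδ0, _, hδ, by positivity, fun n y => card_ball_le_pow y _ hc0 hc1⟩

theorem one_le_floor_two_rpow {R : ℝ} (hR : 0 ≤ R) (n : ℕ) : 1 ≤ ⌊(2 : ℝ) ^ ((n : ℝ) * R)⌋₊ := by
  rw [Nat.one_le_floor_iff]
  exact Real.one_le_rpow one_le_two (by positivity)

open Filter Topology in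
theorem AchievableOnePrivate.le_binaryEntropy {W : WiretapChannel Bool Bool Bool} {p q R : ℝ}
    (hW : IsDegradedBSBC W p q) (h : AchievableOnePrivate W R) : R ≤ binaryEntropy p := by
  classical
  by_contra! hR
  obtain ⟨hR0, h⟩ := h
  have h0 := hW.p_mem.1
  have h1 := hW.p_mem.2
  obtain ⟨v, -, hv1, hv⟩ := hW.exists_factor
  obtain ⟨δ, hδ, B, hB, hB0, hball⟩ := exists_ball_exponent_lt h0 h1 hR
  obtain ⟨θ, ⟨hθ0, hθ1⟩, hθ⟩ := exists_noise_upper_tail h0 (by linarith) hδ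
  -- With `ε = 1/20` the list misses `C` with probability below `3/20 + 1/20 < 1/4`. Taking `K = 4`
  -- and `B ^ n / N ≤ (log 2)/8`, the information is at least `(3/4) · 2 - 4/8 = 1` bit, more than
  -- `ε`.
  obtain ⟨n₀, hn₀⟩ := h (1 / 20) (by norm_num)
  have hl2 : 0 < Real.log 2 := Real.log_pos one_lt_two
  have h2R : (0 : ℝ) < 2 ^ R := by positivity
  have t1 := (tendsto_pow_atTop_nhds_zero_of_lt_one hθ0.le hθ1).eventually
    (gt_mem_nhds (by norm_num : (0 : ℝ) < 1 / 20))
  have t2 := (tendsto_pow_atTop_nhds_zero_of_lt_one (r := B / 2 ^ R) (by positivity)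
    ((div_lt_one h2R).2 hB)).eventually (gt_mem_nhds (by positivity : (0 : ℝ) < Real.log 2 / 16))
  obtain ⟨n, hn1, hn2, hn⟩ := (t1.and (t2.and (eventually_ge_atTop n₀))).exists
  obtain ⟨P, hsound, hconc, hbind, -⟩ := hn₀ n hn
  have hN1 := one_le_floor_two_rpow hR0 n
  have hNhalf : (2 : ℝ) ^ ((n : ℝ) * R) ≤ 2 * ⌊(2 : ℝ) ^ ((n : ℝ) * R)⌋₊ := by
    have ha := (Nat.lt_floor_add_one ((2 : ℝ) ^ ((n : ℝ) * R))).le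
    have hb : (1 : ℝ) ≤ ⌊(2 : ℝ) ^ ((n : ℝ) * R)⌋₊ := by exact_mod_cast hN1
    linarith
  generalize ⌊(2 : ℝ) ^ ((n : ℝ) * R)⌋₊ = N at *
  have : NeZero N := ⟨by omega⟩
  have hNpos : (0 : ℝ) < N := by exact_mod_cast hN1
  obtain ⟨D, hD⟩ := P.exists_decoder hsound hbind
  have hnn := fun ω => law_nonneg (W := W) (rounds := P.rounds) (a := P.alice) (b := P.bob) ω
  have hsum := sum_law (rounds := P.rounds) (a := P.alice) (b := P.bob) (NeZero.ne N) hv hv1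
  -- Bob decodes every word that is plausible given his output.
  let L : BobView n P.bob → Finset (Fin N) := fun vb =>
    ({x : Fin n → Bool | (hammingDist x vb.2.1 : ℝ) ≤ n * (p + δ)} : Finset _).image
      fun x => D x vb.2.2
  have hL : ∀ vb, (#(L vb) : ℝ) ≤ B ^ n := fun vb =>
    le_trans (by exact_mod_cast card_image_le) (hball n vb.2.1)
  have hnoise : prob (law W P.rounds P.alice P.bob)
      {ω | n * (p + δ) < hammingDist (channelInput P.rounds ω) (bobOutput ω)} ≤ θ ^ n := by
    have := sum_law_mul_le (rounds := P.rounds) (a := P.alice) (b := P.bob) (NeZero.ne N) hv hv1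
      (φ := fun _ _ _ e => if n * (p + δ) < hammingDist (fun _ => false) e then 1 else 0)
      (t := θ ^ n) fun c ka => by
        rw [← sum_mul, PMF.sum_toReal, one_mul]
        refine le_of_eq_of_le (sum_congr rfl fun e _ => ?_) (hθ n fun _ => false)
        have : bxor (fun _ => false) e = e := by funext i; simp [bxor]
        rw [this, mul_ite, mul_one, mul_zero]
    refine le_of_eq_of_le ?_ this
    rw [prob_eq_sum_ite]
    refine sum_congr rfl fun ω _ => ?_
    have hd : hammingDist (fun _ => false) (bxor (channelInput P.rounds ω) (bobOutput ω)) =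
        hammingDist (channelInput P.rounds ω) (bobOutput ω) := by
      unfold hammingDist
      congr 1
      refine filter_congr fun i _ => ?_
      simp only [bxor]
      cases channelInput P.rounds ω i <;> cases bobOutput ω i <;> simp
    rw [hd, mul_ite, mul_one, mul_zero]
    simp only [Set.mem_ofPred_eq]
  have hlist : 3 / 4 ≤ prob (law W P.rounds P.alice P.bob)
      {ω | commitString ω ∈ L (bobView P.rounds ω)} := by
    have hc := prob_add_compl (law W P.rounds P.alice P.bob)
      {ω | commitString ω ∈ L (bobView P.rounds ω)}
    rw [hsum] at hc
    have : prob (law W P.rounds P.alice P.bob)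
        {ω | commitString ω ∈ L (bobView P.rounds ω)}ᶜ ≤ 3 * (1 / 20) + θ ^ n := by
      refine (prob_mono hnn ?_).trans ((prob_union_le hnn _ _).trans (add_le_add hD hnoise))
      intro ω hω
      by_contra hcon
      rw [Set.mem_union, not_or] at hcon
      refine hω (mem_image.2 ⟨channelInput P.rounds ω, ?_, ?_⟩)
      · exact mem_filter.2 ⟨mem_univ _, not_lt.1 hcon.2⟩
      · exact (not_not.1 hcon.1).symm
    linarith
  have hI := list_decoding_le_mutualInfo hnn hsum commitString (bobView P.rounds) (K := 4)
    (t := 1 / N) (by norm_num) (by positivity) (fun c => (prob_commitString hv hv1 c).le) L hL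
  have hI2 := mul_le_mul_of_nonneg_right (hconc P.bob) hl2.le
  have hlog4 : Real.log 4 = 2 * Real.log 2 := by
    rw [show (4 : ℝ) = 2 ^ 2 by norm_num, Real.log_pow]; norm_num
  have hsize : B ^ n * (1 / N) ≤ Real.log 2 / 8 := by
    rw [div_pow, ← Real.rpow_natCast (2 ^ R), ← Real.rpow_mul two_pos.le, mul_comm R] at hn2
    rw [div_lt_iff₀ (by positivity)] at hn2
    rw [mul_one_div, div_le_iff₀ hNpos]
    nlinarith
  have := mul_le_mul_of_nonneg_right hlist (Real.log_pos (by norm_num : (1 : ℝ) < 4)).le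
  rw [hlog4] at hI this
  linarith

/-! ### The hashing protocol -/

/-- Public messages: a hash function (from Bob); a hash value, an extractor function and a masked
commit string (from Alice). -/
abbrev HashMsg (N n L : ℕ) :=
  ((Fin n → Bool) → Fin L) × Fin L × ((Fin n → Bool) → Fin N) × Fin N

/-- Alice sends a uniformly random word `x` over the channel; when she has received a hash function
`G`, she replies with `G x`, a random function `S` and `c + S x`. -/
abbrev hashAlice (N n L : ℕ) [NeZero N] [NeZero L] : AliceStrategy N n (HashMsg N n L) where
  Key := (Fin n → Bool) × ((Fin n → Bool) → Fin N)
  keyLaw := PMF.uniformOfFintype _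
  msg := fun c k t => match t with
    -- Alice speaks first, so her first message is a dummy and Bob's hash is the second entry of the
    -- transcript.
    | [_, g] => (0, g.1 k.1, k.2, c + k.2 k.1)
    | _ => (0, 0, 0, 0)
  input := fun _ k i _ => k.1 i

/-- Bob sends a uniformly random hash function. -/
abbrev hashBob (N n L : ℕ) [NeZero N] [NeZero L] : BobStrategy (HashMsg N n L) where
  Key := (Fin n → Bool) → Fin L
  keyLaw := PMF.uniformOfFintype _
  msg := fun G _ _ => (G, 0, 0, 0)

open Classical in
/-- Bob accepts `(c, x)` if it is consistent with Alice's message and `x` is within distance `r` of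
his channel output. -/
def hashTest (N n L : ℕ) [NeZero N] [NeZero L] (r : ℝ) (c : Fin N) (x : Fin n → Bool)
    (vb : BobView n (hashBob N n L)) : Bool :=
  match vb.2.2 with
    | [_, _, m, _] => decide (vb.1 x = m.2.1 ∧ m.2.2.2 = c + m.2.2.1 x ∧
        (hammingDist x vb.2.1 : ℝ) ≤ r)
    | _ => false

/-- The commitment protocol based on random hash functions. -/
def hashProtocol (N n L : ℕ) [NeZero N] [NeZero L] (r : ℝ) : CommitmentProtocol N n where
  Msg := HashMsg N n L
  finiteMsg := inferInstance
  rounds := finalRounds n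
  alice := hashAlice N n L
  bob := hashBob N n L
  test := hashTest N n L r

section HashProtocol

variable {N n L : ℕ} [NeZero N] [NeZero L] {r : ℝ} {W : WiretapChannel Bool Bool Bool} {p : ℝ}
  {v : Bool → Bool → ℝ}

/-- The hash function that Bob sends to honest Alice. -/
def sentHash (b : BobStrategy (HashMsg N n L)) (k : b.Key) (y : Fin n → Bool) :
    (Fin n → Bool) → Fin L :=
  (b.msg k (List.ofFn y) [(0, 0, 0, 0)]).1

/-- The transcript with honest Alice, whose second message is `m`. -/
def hashTranscript (b : BobStrategy (HashMsg N n L)) (k : b.Key) (y : Fin n → Bool)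
    (m : HashMsg N n L) : List (HashMsg N n L) :=
  let g := b.msg k (List.ofFn y) [(0, 0, 0, 0)]
  [(0, 0, 0, 0), g, m, b.msg k (List.ofFn y) [(0, 0, 0, 0), g, m]]

theorem transcript_hashProtocol (b : BobStrategy (HashMsg N n L))
    (ω : Outcome (hashAlice N n L) b) :
    transcript (finalRounds n) ω = hashTranscript b ω.2.2.1 ω.2.2.2.1
      (0, sentHash b ω.2.2.1 ω.2.2.2.1 ω.2.1.1, ω.2.1.2, ω.1 + ω.2.1.2 ω.2.1.1) := by
  unfold transcript stageTranscript
  rw [transcriptAt_finalRounds, exchange_two]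
  rfl

/-- The joint mass of a commit string and an extended view, outside the event that the noise is
atypically likely. -/
theorem prob_hashProtocol_view
    (hv : ∀ x y z, (W x (y, z)).toReal = noiseBit p (xor x y) * v y z) (m : ℝ)
    (b : BobStrategy (HashMsg N n L)) (c : Fin N) (k : b.Key) (y z : Fin n → Bool) (h : Fin L)
    (S : (Fin n → Bool) → Fin N) (D : Fin N) :
    prob (law W (finalRounds n) (hashAlice N n L) b)
      {ω | commitString ω = c ∧ (ω.2.2.1, ω.2.2.2.1, ω.2.2.2.2,
        sentHash b ω.2.2.1 ω.2.2.2.1 ω.2.1.1, ω.2.1.2, ω.1 + ω.2.1.2 ω.2.1.1) = (k, y, z, h, S, D) ∧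
        ω ∉ {ω | m < noiseLaw p (bxor (channelInput (finalRounds n) ω)
          (bobOutput ω))}} =
      ∑ x, if c + S x = D then
        (if sentHash b k y x = h ∧ noiseLaw p (bxor x y) ≤ m then
          (1 / (N : ℝ)) * (1 / (2 ^ n * Fintype.card ((Fin n → Bool) → Fin N))) *
            (b.keyLaw k).toReal * (noiseLaw p (bxor x y) * ∏ i, v (y i) (z i)) else 0) else 0 := by
  classical
  rw [prob_eq_sum_ite]
  symm
  -- The extended view and `c` fix every coordinate of the outcome except the word `x`.
  refine Fintype.sum_of_injective
    (fun x => ((c, (x, S), k, y, z) : Outcome (hashAlice N n L) b))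
    (fun x x' hx => congrArg (fun ω => ω.2.1.1) hx) _ _ (fun ω hω => ?_) fun x => ?_
  · rw [if_neg]
    rintro ⟨h1, h2, -⟩
    simp only [Prod.mk.injEq] at h2
    obtain ⟨h3, h4, h5, -, h6, -⟩ := h2
    exact hω ⟨ω.2.1.1, by rw [← h1, ← h3, ← h4, ← h5, ← h6]; rfl⟩
  · rw [law_eq hv, ← ite_and]
    have hkey : (((hashAlice N n L).keyLaw (x, S)).toReal : ℝ) =
        1 / (2 ^ n * Fintype.card ((Fin n → Bool) → Fin N)) := by
      change ((PMF.uniformOfFintype ((Fin n → Bool) × ((Fin n → Bool) → Fin N))) (x, S)).toReal = _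
      rw [PMF.uniformOfFintype_apply]
      simp
    by_cases hc : c + S x = D ∧ sentHash b k y x = h ∧ noiseLaw p (bxor x y) ≤ m
    · rw [if_pos hc, if_pos ⟨rfl, by simp only [hc.1, hc.2.1], not_lt.2 hc.2.2⟩]
      change _ = (1 / (N : ℝ)) * ((hashAlice N n L).keyLaw (x, S)).toReal *
        (b.keyLaw k).toReal * (noiseLaw p (bxor x y) * ∏ i, v (y i) (z i))
      rw [hkey]
    · rw [if_neg hc, if_neg]
      rintro ⟨-, h2, h3⟩
      simp only [Prod.mk.injEq] at h2
      exact hc ⟨h2.2.2.2.2.2, h2.2.2.2.1, not_lt.1 h3⟩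

/-- Neither Bob nor Eve, nor both of them together, learn the commit string. -/
theorem mutualInfo_hashProtocol_le (h0 : 0 ≤ p) (h1 : p ≤ 1)
    (hv0 : ∀ y z, 0 ≤ v y z) (hv1 : ∀ y, ∑ z, v y z = 1)
    (hv : ∀ x y z, (W x (y, z)).toReal = noiseBit p (xor x y) * v y z) {m τ : ℝ} (hm : 0 ≤ m)
    (hτ : ∑ e : Fin n → Bool, (if m < noiseLaw p e then noiseLaw p e else 0) ≤ τ)
    (b : BobStrategy (HashMsg N n L)) {β : Type*}
    (V : Outcome (hashAlice N n L) b → β)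
    (f : b.Key × (Fin n → Bool) × (Fin n → Bool) × List (HashMsg N n L) → β)
    (hf : ∀ ω, V ω = f (ω.2.2.1, ω.2.2.2.1, ω.2.2.2.2,
      transcript (finalRounds n) ω)) :
    mutualInfo (law W (finalRounds n) (hashAlice N n L) b)
      commitString V * Real.log 2 ≤ τ * Real.log N + N * L * m := by
  classical
  have hNpos : (0 : ℝ) < N := by exact_mod_cast NeZero.pos N
  have hN1 : (1 : ℝ) ≤ N := by exact_mod_cast NeZero.pos N
  have hnn := fun ω => law_nonneg (W := W) (rounds := (finalRounds n)) (a := (hashAlice N n L)) (b := b) ω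
  set Bad : Set (Outcome (hashAlice N n L) b) :=
    {ω | m < noiseLaw p (bxor (channelInput (finalRounds n) ω) (bobOutput ω))} with hBad
  -- The extended view consists of Bob's key, both outputs, the hash value, `S` and the masked
  -- string. All messages, including those of a malicious Bob, are functions of it.
  have hI := mutualInfo_le_of_collision hnn commitString V
    (fun ω => (ω.2.2.1, ω.2.2.2.1, ω.2.2.2.2,
        sentHash b ω.2.2.1 ω.2.2.2.1 ω.2.1.1, ω.2.1.2, ω.1 + ω.2.1.2 ω.2.1.1))
    (fun t => f (t.1, t.2.1, t.2.2.1, hashTranscript b t.1 t.2.1 (0, t.2.2.2)))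
    (fun ω => by rw [hf, transcript_hashProtocol]) hN1 (prob_commitString hv hv1) Bad
  refine hI.trans (add_le_add (mul_le_mul_of_nonneg_right ?_ (Real.log_nonneg hN1)) ?_)
  · have := sum_law_mul_le (rounds := (finalRounds n)) (a := (hashAlice N n L)) (b := b) (NeZero.ne N) hv hv1
      (φ := fun _ _ _ e => if m < noiseLaw p e then 1 else 0) (t := τ) fun c ka => by
        rw [← sum_mul, PMF.sum_toReal, one_mul]
        simpa only [mul_ite, mul_one, mul_zero] using hτ
    refine le_of_eq_of_le ?_ this
    rw [prob_eq_sum_ite]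
    refine sum_congr rfl fun ω _ => ?_
    rw [mul_ite, mul_one, mul_zero]
    simp only [hBad, Set.mem_ofPred_eq]
  · simp only [Fintype.sum_prod_type]
    set C : ℝ := (Fintype.card ((Fin n → Bool) → Fin N) : ℝ) with hC
    have hCpos : 0 < C := by rw [hC]; exact_mod_cast Fintype.card_pos
    set κ : ℝ := 1 / (N : ℝ) * (1 / (2 ^ n * C)) with hκ
    have hκ0 : 0 ≤ κ := by positivity
    calc _ ≤ ∑ k, ∑ y : Fin n → Bool, ∑ z : Fin n → Bool, ∑ _h : Fin L,
          C * (N : ℝ) ^ 2 * (κ * (b.keyLaw k).toReal * (m * ∏ i, v (y i) (z i))) := by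
          refine sum_le_sum fun k _ => sum_le_sum fun y _ => sum_le_sum fun z _ =>
            sum_le_sum fun h _ => ?_
          have hvz : 0 ≤ ∏ i, v (y i) (z i) := prod_nonneg fun i _ => hv0 _ _
          have hk0 : 0 ≤ κ * (b.keyLaw k).toReal := mul_nonneg hκ0 ENNReal.toReal_nonneg
          -- For each fixed `(k, y, z, h)`, hashing is applied to the words consistent with the hash
          -- value `h` and with noise probability at most `m`. Summing over `h` costs the factor
          -- `L`.
          have hl := leftover_hash (A := Fin N) (b := fun x =>
            if sentHash b k y x = h ∧ noiseLaw p (bxor x y) ≤ m then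
              κ * (b.keyLaw k).toReal * (noiseLaw p (bxor x y) * ∏ i, v (y i) (z i)) else 0)
            (m := κ * (b.keyLaw k).toReal * (m * ∏ i, v (y i) (z i)))
            (fun x => by
              split_ifs
              · exact mul_nonneg hk0 (mul_nonneg (noiseLaw_nonneg h0 h1 _) hvz)
              · rfl)
            (fun x => by
              split_ifs with hx
              · exact mul_le_mul_of_nonneg_left (mul_le_mul_of_nonneg_right hx.2 hvz) hk0
              · positivity) (by positivity)
          rw [Fintype.card_fin] at hl
          refine le_trans (le_of_eq ?_) hl
          refine sum_congr rfl fun S _ => sum_congr rfl fun D _ => ?_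
          have := fun c => prob_hashProtocol_view hv m b c k y z h S D
          simp only [hBad, this, hκ, hC]
      _ = C * (N : ℝ) ^ 2 * κ * m * L * 2 ^ n := by
          have hz : ∀ y : Fin n → Bool, ∑ z : Fin n → Bool, ∏ i, v (y i) (z i) = 1 := fun y => by
            rw [sum_prod_bits fun i z => v (y i) z]
            simp only [hv1, prod_const_one]
          have : ∀ k, ∀ y : Fin n → Bool, ∑ z : Fin n → Bool, ∑ _h : Fin L,
              C * (N : ℝ) ^ 2 * (κ * (b.keyLaw k).toReal * (m * ∏ i, v (y i) (z i))) =
              (b.keyLaw k).toReal * (C * (N : ℝ) ^ 2 * κ * m * L) := by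
            intro k y
            rw [← mul_one ((b.keyLaw k).toReal * (C * (N : ℝ) ^ 2 * κ * m * L)), ← hz y, mul_sum]
            refine sum_congr rfl fun z _ => ?_
            simp only [sum_const, card_univ, Fintype.card_fin, nsmul_eq_mul]
            ring
          rw [sum_congr rfl fun k _ => sum_congr rfl fun y _ => this k y]
          simp only [sum_const, card_univ, nsmul_eq_mul, Fintype.card_pi, Fintype.card_bool,
            prod_const, Fintype.card_fin]
          rw [← mul_sum, ← sum_mul, PMF.sum_toReal]
          push_cast
          ring
      _ = N * L * m := by
          rw [hκ]; field_simp

/-- Honest Alice always passes the two consistency checks; only the distance test can fail. -/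
theorem isSound_hashProtocol {θ : ℝ}
    (hv1 : ∀ y, ∑ z, v y z = 1)
    (hv : ∀ x y z, (W x (y, z)).toReal = noiseBit p (xor x y) * v y z)
    (hθ : ∀ x : Fin n → Bool,
      ∑ y, (if r < hammingDist x y then noiseLaw p (bxor x y) else 0) ≤ θ) :
    (hashProtocol N n L r).IsSound W θ := by
  classical
  change prob (law W (finalRounds n) (hashAlice N n L) (hashBob N n L)) {ω | hashTest N n L r
    (commitString ω) (channelInput (finalRounds n) ω) (bobView (finalRounds n) ω) ≠ true} ≤ θ
  have hnn := fun ω => law_nonneg (W := W) (rounds := (finalRounds n)) (a := (hashAlice N n L)) (b := (hashBob N n L)) ω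
  have := sum_law_mul_le (rounds := (finalRounds n)) (a := (hashAlice N n L)) (b := (hashBob N n L)) (NeZero.ne N) hv hv1
    (φ := fun _ ka _ e => if r < hammingDist ka.1 (bxor ka.1 e) then 1 else 0)
    (t := θ) fun c ka => by
      rw [← sum_mul, PMF.sum_toReal, one_mul]
      refine le_trans (le_of_eq ?_) (hθ ka.1)
      rw [← sum_bxor ka.1]
      refine sum_congr rfl fun e _ => ?_
      rw [mul_ite, mul_one, mul_zero, bxor_bxor]
  refine le_trans ?_ this
  rw [prob_eq_sum_ite]
  refine sum_le_sum fun ω _ => ?_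
  have hx : channelInput (finalRounds n) ω = ω.2.1.1 := rfl
  rw [hx, bxor_bxor, mul_ite, mul_one, mul_zero]
  by_cases hd : r < hammingDist ω.2.1.1 (bobOutput ω)
  · rw [if_pos hd]
    split_ifs
    · rfl
    · exact hnn ω
  · rw [if_neg hd, if_neg]
    intro hω
    refine hω ?_
    have ht : (bobView (finalRounds n) ω).2.2 = hashTranscript (hashBob N n L) ω.2.2.1 ω.2.2.2.1
      (0, sentHash (hashBob N n L) ω.2.2.1 ω.2.2.2.1 ω.2.1.1, ω.2.1.2, ω.1 + ω.2.1.2 ω.2.1.1) :=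
      transcript_hashProtocol _ ω
    rw [hashTest, ht]
    simp only [hashTranscript, decide_eq_true_eq]
    exact ⟨rfl, rfl, not_lt.1 hd⟩

end HashProtocol

/-- No message precedes the channel uses, so even a malicious Alice fixes her inputs before she sees
Bob's hash; the ball in which she must find a collision is therefore independent of it. -/
theorem channelInput_finalRounds {N n : ℕ} {Msg : Type} (a : AliceStrategy N n Msg) (b : BobStrategy Msg)
    (ω : Outcome a b) :
    channelInput (finalRounds n) ω = fun i => a.input ω.1 ω.2.1 i [] := by
  funext i
  unfold channelInput stageTranscript
  rw [transcriptAt_finalRounds_lt _ _ _ i.2]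

/-! ### Binding of the hashing protocol against a malicious Alice. -/

section Binding

variable {N n L : ℕ} [NeZero N] [NeZero L] {W : WiretapChannel Bool Bool Bool} {p : ℝ}
  {v : Bool → Bool → ℝ}

/-- A random function has a collision on a small set with small probability. -/
theorem collision_prob_le (T : Finset (Fin n → Bool)) :
    (#{G : (Fin n → Bool) → Fin L | ∃ x ∈ T, ∃ x' ∈ T, x ≠ x' ∧ G x = G x'} : ℝ) ≤
      Fintype.card ((Fin n → Bool) → Fin L) * ((#T : ℝ) ^ 2 / L) := by
  classical
  have hL : (0 : ℝ) < L := by exact_mod_cast NeZero.pos L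
  have hsub : ({G : (Fin n → Bool) → Fin L | ∃ x ∈ T, ∃ x' ∈ T, x ≠ x' ∧ G x = G x'} : Finset _) ⊆
      ((T ×ˢ T).filter fun t => t.1 ≠ t.2).biUnion fun t =>
        ({G : (Fin n → Bool) → Fin L | G t.1 = G t.2} : Finset _) := by
    intro G hG
    simp only [mem_filter, mem_univ, true_and] at hG
    obtain ⟨x, hx, x', hx', hne, he⟩ := hG
    simp only [mem_biUnion, mem_filter, mem_univ, true_and, mem_product]
    exact ⟨(x, x'), ⟨⟨hx, hx'⟩, hne⟩, he⟩
  calc _ ≤ ∑ t ∈ (T ×ˢ T).filter fun t => t.1 ≠ t.2,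
        (#{G : (Fin n → Bool) → Fin L | G t.1 = G t.2} : ℝ) := by
        exact_mod_cast (card_le_card hsub).trans card_biUnion_le
    _ = ∑ t ∈ (T ×ˢ T).filter fun t => t.1 ≠ t.2,
        (Fintype.card ((Fin n → Bool) → Fin L) : ℝ) / L := by
        refine sum_congr rfl fun t ht => ?_
        have := card_mul_card_collision (A := Fin L) (mem_filter.1 ht).2
        rw [Fintype.card_fin] at this
        rw [eq_div_iff hL.ne', mul_comm]
        exact_mod_cast this
    _ ≤ (#T : ℝ) ^ 2 * ((Fintype.card ((Fin n → Bool) → Fin L) : ℝ) / L) := by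
        rw [sum_const, nsmul_eq_mul]
        refine mul_le_mul_of_nonneg_right ?_ (by positivity)
        have := card_filter_le (T ×ˢ T) fun t => t.1 ≠ t.2
        rw [card_product] at this
        rw [sq]
        exact_mod_cast this
    _ = _ := by ring

/-- Alice's second message, when Bob's hash function is `G`. -/
def replyTo (a : AliceStrategy N n (HashMsg N n L)) (c : Fin N) (k : a.Key)
    (G : (Fin n → Bool) → Fin L) : HashMsg N n L :=
  a.msg c k [a.msg c k [], (G, 0, 0, 0)]

theorem transcript_hashBob (a : AliceStrategy N n (HashMsg N n L))
    (ω : Outcome a (hashBob N n L)) :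
    transcript (finalRounds n) ω = [a.msg ω.1 ω.2.1 [], (ω.2.2.1, 0, 0, 0),
      replyTo a ω.1 ω.2.1 ω.2.2.1, (ω.2.2.1, 0, 0, 0)] := by
  unfold transcript stageTranscript
  rw [transcriptAt_finalRounds, exchange_two]
  rfl

/-- A malicious Alice can open two different commit strings only with small probability. -/
theorem prob_double_opening_le {θ β : ℝ} {r ρ : ℝ}
    (hv1 : ∀ y, ∑ z, v y z = 1)
    (hv : ∀ x y z, (W x (y, z)).toReal = noiseBit p (xor x y) * v y z)
    (hθ : ∀ x u : Fin n → Bool, ρ ≤ hammingDist x u →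
      ∑ y, (if hammingDist u y ≤ r then noiseLaw p (bxor x y) else 0) ≤ θ)
    (hβ : ∀ y : Fin n → Bool, (#{x : Fin n → Bool | (hammingDist x y : ℝ) ≤ ρ} : ℝ) ≤ β)
    (hθ0 : 0 ≤ θ) (a : AliceStrategy N n (HashMsg N n L))
    (A : AliceView a → (Fin N × (Fin n → Bool)) × (Fin N × (Fin n → Bool))) :
    prob (law W (finalRounds n) a (hashBob N n L))
      {ω | (A (aliceView (finalRounds n) ω)).1.1 ≠ (A (aliceView (finalRounds n) ω)).2.1 ∧
        hashTest N n L r (A (aliceView (finalRounds n) ω)).1.1 (A (aliceView (finalRounds n) ω)).1.2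
          (bobView (finalRounds n) ω) = true ∧
        hashTest N n L r (A (aliceView (finalRounds n) ω)).2.1 (A (aliceView (finalRounds n) ω)).2.2
          (bobView (finalRounds n) ω) = true} ≤ β ^ 2 / L + 2 * θ := by
  classical
  let X : Fin N → a.Key → Fin n → Bool := fun c k i => a.input c k i []
  -- Bob's messages reveal nothing but `G`, so Alice's two openings are functions of `(c, k, G)` and
  -- are independent of the noise.
  let F : Fin N → a.Key → ((Fin n → Bool) → Fin L) →
      (Fin N × (Fin n → Bool)) × (Fin N × (Fin n → Bool)) := fun c k G =>
    A (c, k, X c k, [a.msg c k [], (G, 0, 0, 0), replyTo a c k G, (G, 0, 0, 0)])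
  -- A successful double opening requires either an accepted word far from `x` or two distinct
  -- nearby words with equal hash: a single word would determine the commit string through the
  -- masked value.
  let coll : Fin N → a.Key → ((Fin n → Bool) → Fin L) → Prop := fun c k G =>
    ∃ x ∈ ({x : Fin n → Bool | (hammingDist x (X c k) : ℝ) ≤ ρ} : Finset _),
      ∃ x' ∈ ({x : Fin n → Bool | (hammingDist x (X c k) : ℝ) ≤ ρ} : Finset _),
        x ≠ x' ∧ G x = G x'
  let far : (Fin n → Bool) → (Fin n → Bool) → (Fin n → Bool) → ℝ := fun x u e =>
    if ρ ≤ hammingDist x u ∧ hammingDist u (bxor x e) ≤ r then 1 else 0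
  have hfar : ∀ x u, ∑ e : Fin n → Bool, noiseLaw p e * far x u e ≤ θ := by
    intro x u
    by_cases hd : ρ ≤ hammingDist x u
    · refine le_trans (le_of_eq ?_) (hθ x u hd)
      rw [← sum_bxor x]
      refine sum_congr rfl fun e _ => ?_
      simp only [far, hd, true_and]
      rw [bxor_bxor, mul_ite, mul_one, mul_zero]
    · simpa [far, hd] using hθ0
  have hmain := sum_law_mul_le (W := W) (rounds := finalRounds n) (a := a) (b := hashBob N n L)
    (NeZero.ne N) hv hv1
    (φ := fun c k G e => (if coll c k G then 1 else 0) + far (X c k) (F c k G).1.2 e +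
      far (X c k) (F c k G).2.2 e) (t := β ^ 2 / L + 2 * θ) fun c k => by
    have hcard : (0 : ℝ) < Fintype.card ((Fin n → Bool) → Fin L) := by
      exact_mod_cast Fintype.card_pos
    have hkey : ∀ G, ((hashBob N n L).keyLaw G).toReal =
        1 / (Fintype.card ((Fin n → Bool) → Fin L) : ℝ) := fun G => by
      change ((PMF.uniformOfFintype ((Fin n → Bool) → Fin L)) G).toReal = _
      rw [PMF.uniformOfFintype_apply]
      simp
    calc _ ≤ ∑ G, ((hashBob N n L).keyLaw G).toReal * ((if coll c k G then 1 else 0) + 2 * θ) := by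
          refine sum_le_sum fun G _ => mul_le_mul_of_nonneg_left ?_ ENNReal.toReal_nonneg
          simp only [mul_add, sum_add_distrib]
          rw [← sum_mul, sum_noiseLaw, one_mul]
          linarith [hfar (X c k) (F c k G).1.2, hfar (X c k) (F c k G).2.2]
      _ = 1 / (Fintype.card ((Fin n → Bool) → Fin L) : ℝ) *
            (#{G | coll c k G} : ℝ) + 2 * θ := by
          simp only [mul_add, sum_add_distrib]
          rw [← sum_mul, PMF.sum_toReal, one_mul]
          congr 1
          simp only [hkey]
          rw [← mul_sum, sum_boole]
      _ ≤ _ := by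
          gcongr
          have := collision_prob_le (L := L)
            ({x : Fin n → Bool | (hammingDist x (X c k) : ℝ) ≤ ρ} : Finset _)
          rw [one_div_mul_eq_div, div_le_iff₀ hcard, mul_comm]
          refine this.trans ?_
          gcongr
          exact hβ _
  have hf0 : ∀ x u e, 0 ≤ far x u e := fun x u e => by
    simp only [far]; split_ifs <;> norm_num
  have hc0 : ∀ c k G, (0 : ℝ) ≤ if coll c k G then 1 else 0 := fun c k G => by
    split_ifs <;> norm_num
  refine (prob_le_sum_mul law_nonneg (fun ω => add_nonneg (add_nonneg (hc0 _ _ _) (hf0 _ _ _))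
    (hf0 _ _ _)) fun ω hω => ?_).trans hmain
  have hX : channelInput (finalRounds n) ω = X ω.1 ω.2.1 := channelInput_finalRounds _ _ ω
  have hview : A (aliceView (finalRounds n) ω) = F ω.1 ω.2.1 ω.2.2.1 := by
    simp only [aliceView, F]
    rw [hX, transcript_hashBob]
  have htest : ∀ c x, hashTest N n L r c x (bobView (finalRounds n) ω) = true →
      ω.2.2.1 x = (replyTo a ω.1 ω.2.1 ω.2.2.1).2.1 ∧ (replyTo a ω.1 ω.2.1 ω.2.2.1).2.2.2 =
        c + (replyTo a ω.1 ω.2.1 ω.2.2.1).2.2.1 x ∧ (hammingDist x (bobOutput ω) : ℝ) ≤ r := by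
    intro c x h
    unfold hashTest bobView at h
    rw [transcript_hashBob] at h
    simpa only [decide_eq_true_eq] using h
  have g0 := hc0 ω.1 ω.2.1 ω.2.2.1
  have g1 := hf0 (X ω.1 ω.2.1) (F ω.1 ω.2.1 ω.2.2.1).1.2 (bxor (X ω.1 ω.2.1) (bobOutput ω))
  have g2 := hf0 (X ω.1 ω.2.1) (F ω.1 ω.2.1 ω.2.2.1).2.2 (bxor (X ω.1 ω.2.1) (bobOutput ω))
  rw [hX]
  obtain ⟨hne, ht1, ht2⟩ := hω
  rw [hview] at hne ht1 ht2
  obtain ⟨e1, d1, r1⟩ := htest _ _ ht1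
  obtain ⟨e2, d2, r2⟩ := htest _ _ ht2
  by_cases hd1 : ρ ≤ hammingDist (X ω.1 ω.2.1) (F ω.1 ω.2.1 ω.2.2.1).1.2
  · have : far (X ω.1 ω.2.1) (F ω.1 ω.2.1 ω.2.2.1).1.2 (bxor (X ω.1 ω.2.1) (bobOutput ω)) = 1 :=
      if_pos ⟨hd1, by rw [bxor_bxor]; exact r1⟩
    linarith
  by_cases hd2 : ρ ≤ hammingDist (X ω.1 ω.2.1) (F ω.1 ω.2.1 ω.2.2.1).2.2
  · have : far (X ω.1 ω.2.1) (F ω.1 ω.2.1 ω.2.2.1).2.2 (bxor (X ω.1 ω.2.1) (bobOutput ω)) = 1 :=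
      if_pos ⟨hd2, by rw [bxor_bxor]; exact r2⟩
    linarith
  have hcoll : coll ω.1 ω.2.1 ω.2.2.1 := by
    refine ⟨(F ω.1 ω.2.1 ω.2.2.1).1.2, ?_, (F ω.1 ω.2.1 ω.2.2.1).2.2, ?_, fun he => ?_,
      e1.trans e2.symm⟩
    · rw [mem_filter_univ, hammingDist_comm]; exact (not_le.1 hd1).le
    · rw [mem_filter_univ, hammingDist_comm]; exact (not_le.1 hd2).le
    · apply hne
      rw [d1, he] at d2
      exact add_right_cancel d2
  rw [if_pos hcoll]
  linarith

theorem isOneBinding_hashProtocol {θ β : ℝ} {r ρ : ℝ}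
    (hv1 : ∀ y, ∑ z, v y z = 1)
    (hv : ∀ x y z, (W x (y, z)).toReal = noiseBit p (xor x y) * v y z)
    (hθ : ∀ x u : Fin n → Bool, ρ ≤ hammingDist x u →
      ∑ y, (if hammingDist u y ≤ r then noiseLaw p (bxor x y) else 0) ≤ θ)
    (hβ : ∀ y : Fin n → Bool, (#{x : Fin n → Bool | (hammingDist x y : ℝ) ≤ ρ} : ℝ) ≤ β)
    (hθ0 : 0 ≤ θ) :
    (hashProtocol N n L r).IsOneBinding W (β ^ 2 / L + 2 * θ) :=
  fun a A => prob_double_opening_le hv1 hv hθ hβ hθ0 a A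

end Binding

/-! ### Achievability -/

/-- Hamming balls of small radius have small exponents. -/
theorem exists_small_ball {η : ℝ} (hη : 0 < η) : ∃ α > 0, ∀ (n : ℕ) (y : Fin n → Bool),
    (#{x : Fin n → Bool | (hammingDist x y : ℝ) ≤ n * α} : ℝ) ≤ ((2 : ℝ) ^ η) ^ n := by
  have h2 : 1 < (2 : ℝ) ^ η := Real.one_lt_rpow one_lt_two hη
  -- This gives `1 + c ≤ (1 + 2 ^ η)/2 < 2 ^ η`, and `c ^ (-α)` tends to `1` as `α → 0`.
  set c : ℝ := min 1 (((2 : ℝ) ^ η - 1) / 2) with hc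
  have hc0 : 0 < c := lt_min one_pos (by linarith)
  have hc2 : c ≤ ((2 : ℝ) ^ η - 1) / 2 := min_le_right _ _
  have hcont : Continuous fun α : ℝ => (1 + c) * c ^ (-α) :=
    continuous_const.mul (continuous_const.rpow (by fun_prop) fun _ => Or.inl hc0.ne')
  have hlt : (1 + c) * c ^ (-(0 : ℝ)) < (2 : ℝ) ^ η := by
    rw [neg_zero, Real.rpow_zero]; linarith
  obtain ⟨α, hα, hα0⟩ := ((((hcont.tendsto 0).eventually (gt_mem_nhds hlt)).filter_mono
    (nhdsWithin_le_nhds (s := Set.Ioi 0))).and self_mem_nhdsWithin).exists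
  refine ⟨α, hα0, fun n y => (card_ball_le_pow y α hc0 (min_le_left _ _)).trans ?_⟩
  exact pow_le_pow_left₀ (by positivity) hα.le n

open Filter Topology in
theorem achievableOnePrivate_of_lt {W : WiretapChannel Bool Bool Bool} {p q R : ℝ}
    (hW : IsDegradedBSBC W p q) (hR0 : 0 ≤ R) (hR : R < binaryEntropy p) :
    AchievableOnePrivate W R := by
  refine ⟨hR0, fun ε hε => ?_⟩
  have h0 := hW.p_mem.1
  have h1 := hW.p_mem.2
  have hl2 : 0 < Real.log 2 := Real.log_pos one_lt_two
  obtain ⟨v, hv0, hv1, hv⟩ := hW.exists_factor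
  -- Exponent budget: balls have size at most `2 ^ (n η/4)` and `L ≈ 2 ^ (n η)`, so hash collisions
  -- cost `2 ^ (-n η/2)`; with `m = 2 ^ (-n (H(p) - η))` the leakage `N L m` is at most `2 · 2 ^ (n
  -- (R + 2η - H(p))) = 2 · 2 ^ (-2 n η)`.
  set η := (binaryEntropy p - R) / 4 with hη
  have hη0 : 0 < η := by rw [hη]; linarith
  obtain ⟨α, hα, hball⟩ := exists_small_ball (show 0 < η / 4 by linarith)
  obtain ⟨θ₁, ⟨hθ₁0, hθ₁1⟩, hθ₁⟩ := exists_noise_far_tail h0 h1 hα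
  -- The slack in the acceptance radius must be the one for which far words are rejected, so that a
  -- single test serves soundness and binding.
  obtain ⟨θ₂, ⟨hθ₂0, hθ₂1⟩, hθ₂⟩ := exists_noise_upper_tail h0 (by linarith)
    (show 0 < α * (1 - 2 * p) / 4 from div_pos (mul_pos hα (by linarith)) (by norm_num))
  obtain ⟨θ₃, ⟨hθ₃0, hθ₃1⟩, hθ₃⟩ := exists_noise_typical h0 (by linarith) hη0
  have two_lt : ∀ {s : ℝ}, 0 < s → (2 : ℝ) ^ (-s) < 1 := fun hs =>
    Real.rpow_lt_one_of_one_lt_of_neg one_lt_two (by linarith)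
  have t1 : Tendsto (fun n : ℕ => ((2 : ℝ) ^ (-(η / 2))) ^ n + 2 * θ₁ ^ n) atTop (𝓝 0) := by
    simpa using (tendsto_pow_atTop_nhds_zero_of_lt_one (by positivity)
      (two_lt (half_pos hη0))).add
        ((tendsto_pow_atTop_nhds_zero_of_lt_one hθ₁0.le hθ₁1).const_mul 2)
  have t2 := tendsto_pow_atTop_nhds_zero_of_lt_one hθ₂0.le hθ₂1
  have t3 : Tendsto (fun n : ℕ => (R * Real.log 2) * (n * θ₃ ^ n) +
      2 * ((2 : ℝ) ^ (-(2 * η))) ^ n) atTop (𝓝 0) := by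
    simpa using ((tendsto_self_mul_const_pow_of_lt_one hθ₃0.le hθ₃1).const_mul
      (R * Real.log 2)).add ((tendsto_pow_atTop_nhds_zero_of_lt_one (by positivity)
        (two_lt (show 0 < 2 * η by linarith))).const_mul 2)
  obtain ⟨n₀, hn₀⟩ := eventually_atTop.1 ((t1.eventually (gt_mem_nhds hε)).and
    ((t2.eventually (gt_mem_nhds hε)).and
      (t3.eventually (gt_mem_nhds (show 0 < ε * Real.log 2 by positivity)))))
  refine ⟨n₀, fun n hn => ?_⟩
  obtain ⟨b1, b2, b3⟩ := hn₀ n hn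
  have hN1 := one_le_floor_two_rpow hR0 n
  have hNle := Nat.floor_le (show (0 : ℝ) ≤ (2 : ℝ) ^ ((n : ℝ) * R) by positivity)
  generalize ⌊(2 : ℝ) ^ ((n : ℝ) * R)⌋₊ = N at *
  have : NeZero N := ⟨by omega⟩
  have hNpos : (0 : ℝ) < N := by exact_mod_cast hN1
  obtain ⟨L, hL1, hL2⟩ : ∃ L : ℕ, (2 : ℝ) ^ (n * η) ≤ L ∧ (L : ℝ) ≤ 2 * (2 : ℝ) ^ (n * η) := by
    refine ⟨⌈(2 : ℝ) ^ (n * η)⌉₊, Nat.le_ceil _, ?_⟩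
    have h3 := (Nat.ceil_lt_add_one (show (0 : ℝ) ≤ (2 : ℝ) ^ (n * η) by positivity)).le
    have h4 : (1 : ℝ) ≤ (2 : ℝ) ^ (n * η) := Real.one_le_rpow one_le_two (by positivity)
    linarith
  have hLpos : (0 : ℝ) < L := lt_of_lt_of_le (by positivity) hL1
  have : NeZero L := ⟨fun h => by simp [h] at hLpos⟩
  set m : ℝ := (2 : ℝ) ^ (-(n * (binaryEntropy p - η))) with hm
  have hbound : θ₃ ^ n * Real.log N + N * L * m ≤ ε * Real.log 2 := by
    refine le_trans (add_le_add ?_ ?_) b3.le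
    · have := Real.log_le_log hNpos hNle
      rw [Real.log_rpow two_pos] at this
      have := mul_le_mul_of_nonneg_left this (pow_nonneg hθ₃0.le n)
      linarith
    · calc (N : ℝ) * L * m ≤ (2 : ℝ) ^ ((n : ℝ) * R) * (2 * (2 : ℝ) ^ (n * η)) * m := by gcongr
        _ = 2 * ((2 : ℝ) ^ ((n : ℝ) * R) * (2 : ℝ) ^ (n * η) * m) := by ring
        _ = 2 * ((2 : ℝ) ^ (-(2 * η))) ^ n := by
          rw [hm, ← Real.rpow_add two_pos, ← Real.rpow_add two_pos, ← Real.rpow_natCast (2 ^ _),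
            ← Real.rpow_mul two_pos.le]
          congr 2
          rw [hη]; ring
  refine ⟨hashProtocol N n L (n * (p + α * (1 - 2 * p) / 4)), ?_, ?_, ?_, ?_⟩
  · exact (isSound_hashProtocol hv1 hv (hθ₂ n)).trans b2.le
  · intro b
    refine le_of_mul_le_mul_right (le_trans ?_ hbound) hl2
    exact mutualInfo_hashProtocol_le h0.le (by linarith) hv0 hv1 hv (by positivity) (hθ₃ n) b
      (bobView (finalRounds n)) (fun t => (t.1, t.2.1, t.2.2.2)) fun ω => rfl
  · intro a A
    refine (isOneBinding_hashProtocol (β := ((2 : ℝ) ^ (η / 4)) ^ n) hv1 hv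
      (hθ₁ n) (hball n) (by positivity) a A).trans (le_trans ?_ b1.le)
    gcongr
    rw [div_le_iff₀ hLpos]
    calc (((2 : ℝ) ^ (η / 4)) ^ n) ^ 2 = ((2 : ℝ) ^ (-(η / 2))) ^ n * (2 : ℝ) ^ (n * η) := by
          simp only [← Real.rpow_natCast, ← Real.rpow_mul two_pos.le]
          rw [← Real.rpow_add two_pos]
          congr 1
          push_cast; ring
      _ ≤ _ := by gcongr
  · refine le_of_mul_le_mul_right (le_trans ?_ hbound) hl2
    exact mutualInfo_hashProtocol_le h0.le (by linarith) hv0 hv1 hv (by positivity) (hθ₃ n)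
      (hashBob N n L) (eveView (finalRounds n)) (fun t => t.2.2) fun ω => rfl

theorem binaryEntropy_pos {p : ℝ} (h0 : 0 < p) (h1 : p < 1) : 0 < binaryEntropy p := by
  have h2 := binaryEntropy_mul_log_two p
  have h3 := Real.log_neg h0 h1
  have h4 := Real.log_neg (show 0 < 1 - p by linarith) (by linarith)
  refine pos_of_mul_pos_left (b := Real.log 2) ?_ (Real.log_pos one_lt_two).le
  rw [h2]
  nlinarith

end WiretapCommitment

end

theorem mainTheorem3 (p q : ℝ) (W : WiretapCommitment.WiretapChannel Bool Bool Bool)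
    (hW : WiretapCommitment.IsDegradedBSBC W p q) :
    WiretapCommitment.IsOnePrivateCapacity W (WiretapCommitment.binaryEntropy p) := by
  refine ⟨fun R hR => WiretapCommitment.AchievableOnePrivate.le_binaryEntropy hW hR,
    fun b hb => le_of_forall_lt fun R hR => ?_⟩
  have h0 := hW.p_mem.1
  have h1 := hW.p_mem.2
  -- Achievable rates are nonnegative, hence the maximum with `0`, which is below `H(p)` because
  -- `H(p) > 0`.
  obtain ⟨R', hR', hR''⟩ := exists_between
    (max_lt hR (WiretapCommitment.binaryEntropy_pos h0 (by linarith)))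
  exact (le_max_left _ _).trans_lt hR' |>.trans_le
    (hb (WiretapCommitment.achievableOnePrivate_of_lt hW ((le_max_right _ _).trans hR'.le) hR''))
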